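/- **Setting.** Let $\mathbf H_c\in\mathbb C^{N_c\times M}$, $\theta\in\mathbb R$, $\alpha\in\mathbb C\setminus\{0\}$, $L\ge 1$ an integer, and $\sigma_s,\sigma_c,P,\Gamma>0$. For $n\ge 1$ let the $k$-th entry ($k=0,\dots,n-1$) of the array steering vector of length $n$ be $e^{j(k-\frac{n-1}2)\pi\sin\theta}$; let $\mathbf a(\theta)\in\mathbb C^M$ and $\mathbf b(\theta)\in\mathbb C^{N_s}$ be the steering vectors of lengths $M$ and $N_s$, $\mathbf A=\mathbf b\mathbf a^T$ and $\dot{\mathbf A}=\partial\mathbf A/\partial\theta=\mathbf b\dot{\mathbf a}^T+\dot{\mathbf b}\mathbf a^T$. For $\mathbf Q\succeq 0$ ($M\times M$) put $$R(\mathbf Q)=\log_2\det\Big(\mathbf I+\tfrac1{\sigma_c^2}\mathbf H_c\mathbf Q\mathbf H_c^H\Big),\qquad D(\mathbf Q)=\operatorname{tr}(\dot{\mathbf A}^H\dot{\mathbf A}\mathbf Q)\operatorname{tr}(\mathbf A^H\mathbf A\mathbf Q)-|\operatorname{tr}(\dot{\mathbf A}^H\mathbf A\mathbf Q)|^2,$$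 and, when $D(\mathbf Q)>0$, $\mathrm{CRB}(\mathbf Q)=\dfrac{\sigma_s^2\operatorname{tr}(\mathbf A^H\mathbf A\mathbf Q)}{2|\alpha|^2L\,D(\mathbf Q)}$. With $\tilde\Gamma=2\Gamma L|\alpha|^2/\sigma_s^2$ let $$F(\mathbf Q)=\begin{bmatrix}\operatorname{tr}(\dot{\mathbf A}^H\dot{\mathbf A}\mathbf Q)-1/\tilde\Gamma&\operatorname{tr}(\dot{\mathbf A}^H\mathbf A\mathbf Q)\\ \operatorname{tr}(\mathbf A^H\dot{\mathbf A}\mathbf Q)&\operatorname{tr}(\mathbf A^H\mathbf A\mathbf Q)\end{bmatrix}.$$ The problem (P1.1) is to maximize $R(\mathbf Q)$ over $\mathbf Q\succeq0$ subject to $F(\mathbf Q)\succeq 0$ and $\operatorname{tr}\mathbf Q\le P$. For $\lambda\ge0$ and a Hermitian $2\times2$ matrix $\mathbf Z\succeq0$ define $$\mathcal L(\mathbf Q,\lambda,\mathbf Z)=R(\mathbf Q)-\lambda(\operatorname{tr}\mathbf Q-P)+\operatorname{tr}(\mathbf ZF(\mathbf Q)),\qquad g(\lambda,\mathbf Z)=\sup_{\mathbf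 Q\succeq0}\mathcal L(\mathbf Q,\lambda,\mathbf Z)\in(-\infty,\infty],$$ $$\mathbf C(\lambda,\mathbf Z)=\lambda\mathbf I-\big(Z_{11}\dot{\mathbf A}^H\dot{\mathbf A}+Z_{12}\mathbf A^H\dot{\mathbf A}+Z_{21}\dot{\mathbf A}^H\mathbf A+Z_{22}\mathbf A^H\mathbf A\big),$$ so that $\mathcal L(\mathbf Q,\lambda,\mathbf Z)=R(\mathbf Q)+\lambda P-Z_{11}/\tilde\Gamma-\operatorname{tr}(\mathbf C(\lambda,\mathbf Z)\mathbf Q)$. The dual problem (D1.1) is to minimize $g(\lambda,\mathbf Z)$ over $\lambda\ge0$, $\mathbf Z\succeq0$. Assume that $\Gamma$ exceeds the smallest CRB attainable with power $P$, i.e. that some $\mathbf Q\succeq0$ with $\operatorname{tr}\mathbf Q\le P$ has $D(\mathbf Q)>0$ and $\mathrm{CRB}(\mathbf Q)<\Gamma$. **Claim.** 1. For $\mathbf Q\succeq0$ with $\operatorname{tr}(\mathbf A^H\mathbf A\mathbf Q)>0$: $F(\mathbf Q)\succeq0$ if and only if $D(\mathbf Q)>0$ and $\mathrm{CRB}(\mathbf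 Q)\le\Gamma$. 2. (P1.1) is convex: $R$ is concave on $\{\mathbf Q\succeq0\}$, and the sets $\{F(\mathbf Q)\succeq0\}$, $\{\operatorname{Re}\operatorname{tr}\mathbf Q\le P\}$ and the feasible set are convex. 3. Strong duality holds: (P1.1) and (D1.1) both attain their optima, and the optimal values are equal. 4. If $\lambda\ge0$, $\mathbf Z\succeq0$ and $g(\lambda,\mathbf Z)<\infty$, then $\mathbf C(\lambda,\mathbf Z)\succeq0$, and $\mathcal R(\mathbf V_{c1})\subseteq\mathcal R(\mathbf U_1)$, where $\mathbf V_{c1}$ consists of the right singular vectors of $\mathbf H_c$ with non-zero singular value (for any SVD of $\mathbf H_c$) and $\mathbf U_1$ of the eigenvectors of $\mathbf C(\lambda,\mathbf Z)$ with non-zero eigenvalue (for any eigenvalue decomposition). 5. Let $(\lambda^{\rm opt},\mathbf Z^{\rm opt})$ be any optimal solution of (D1.1) with $\mathbf C=\mathbf C(\lambda^{\rm opt},\mathbf Z^{\rm opt})\succ0$, and let $\mathbf G=\mathbf H_c\mathbf C^{-1/2}=\mathbf U_G\mathbf\Sigma_G\mathbf V_G^H$ be any SVD ($\mathbf U_G$,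 $\mathbf V_G$ unitary) with $\mathbf\Sigma_G^H\mathbf\Sigma_G=\operatorname{diag}(\zeta_1^2,\dots,\zeta_M^2)$, $\zeta_k\ge0$. Then (P1.1) has exactly one optimal solution, namely $$\mathbf Q=\mathbf C^{-1/2}\mathbf V_G\operatorname{diag}(p_1,\dots,p_M)\mathbf V_G^H\mathbf C^{-1/2},\qquad p_k=\Big(\frac1{\ln2}-\frac{\sigma_c^2}{\zeta_k^2}\Big)^+,$$ where $p_k=0$ if $\zeta_k=0$. -/

import Mathlib

open scoped Matrix ComplexOrder

namespace ISAC

noncomputable section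

/-- Data of the point-target ISAC problem: `Nc × M` communication channel, `Ns` receive antennas of
the radar, target angle, reflection coefficient, number of symbols, standard deviations of the
sensing and the communication noise, power budget, and CRB threshold. -/
structure PointTarget (Nc Ns M : ℕ) where
  Hc : Matrix (Fin Nc) (Fin M) ℂ
  θ : ℝ
  α : ℂ
  L : ℕ
  σs : ℝ
  σc : ℝ
  P : ℝ
  Γ : ℝ

/-- The centred position `k - (n - 1) / 2` of the `k`-th antenna (counted from `0`). -/
def position (n : ℕ) (k : Fin n) : ℝ := (k : ℝ) - ((n : ℝ) - 1) / 2

/-- Steering vector of an `n`-element half-wavelength uniform linear array. -/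
def steering (n : ℕ) (θ : ℝ) (k : Fin n) : ℂ :=
  Complex.exp (Complex.I * ((position n k * Real.pi * Real.sin θ : ℝ) : ℂ))

/-- Derivative of the steering vector with respect to the angle. -/
def steeringDot (n : ℕ) (θ : ℝ) (k : Fin n) : ℂ :=
  Complex.I * steering n θ k * ((position n k * Real.pi * Real.cos θ : ℝ) : ℂ)

/-- `A(θ) = b(θ) a(θ)ᵀ`. -/
def response (Ns M : ℕ) (θ : ℝ) : Matrix (Fin Ns) (Fin M) ℂ :=
  Matrix.vecMulVec (steering Ns θ) (steering M θ)

/-- `Ȧ(θ) = b(θ) ȧ(θ)ᵀ + ḃ(θ) a(θ)ᵀ`. -/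
def responseDot (Ns M : ℕ) (θ : ℝ) : Matrix (Fin Ns) (Fin M) ℂ :=
  Matrix.vecMulVec (steering Ns θ) (steeringDot M θ) +
    Matrix.vecMulVec (steeringDot Ns θ) (steering M θ)

theorem hasDerivAt_steering (n : ℕ) (θ : ℝ) (k : Fin n) :
    HasDerivAt (fun t => steering n t k) (steeringDot n θ k) θ := by
  have h1 : HasDerivAt (fun t : ℝ => position n k * Real.pi * Real.sin t)
      (position n k * Real.pi * Real.cos θ) θ :=
    (Real.hasDerivAt_sin θ).const_mul _
  have h2 := (h1.ofReal_comp.const_mul Complex.I).cexp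
  refine h2.congr_deriv ?_
  simp only [steeringDot, steering]
  ring

/-- `Ȧ(θ)` is the entrywise derivative of `A(θ)`. -/
theorem hasDerivAt_response (Ns M : ℕ) (θ : ℝ) (i : Fin Ns) (j : Fin M) :
    HasDerivAt (fun t => response Ns M t i j) (responseDot Ns M θ i j) θ := by
  have h := (hasDerivAt_steering Ns θ i).mul (hasDerivAt_steering M θ j)
  refine h.congr_deriv ?_
  simp only [responseDot, Matrix.add_apply, Matrix.vecMulVec_apply]
  ring

/-- `C^{-1/2}` for a positive definite `C`, by the functional calculus. -/
def invSqrt {M : ℕ} (C : Matrix (Fin M) (Fin M) ℂ) : Matrix (Fin M) (Fin M) ℂ :=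
  cfc (fun x : ℝ => (Real.sqrt x)⁻¹) C

theorem invSqrt_isHermitian {M : ℕ} (C : Matrix (Fin M) (Fin M) ℂ) : (invSqrt C).IsHermitian :=
  cfc_predicate (R := ℝ) (p := IsSelfAdjoint) _ C

theorem invSqrt_mul_self {M : ℕ} {C : Matrix (Fin M) (Fin M) ℂ} (hC : C.PosDef) :
    invSqrt C * invSqrt C * C = 1 := by
  have hsa : IsSelfAdjoint C := hC.isHermitian
  have hcont : ∀ f : ℝ → ℝ, ContinuousOn f (spectrum ℝ C) := fun f =>
    (Matrix.finite_real_spectrum (A := C)).continuousOn f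
  have hpos : ∀ x ∈ spectrum ℝ C, 0 < x := by
    intro x hx
    rw [hC.isHermitian.spectrum_real_eq_range_eigenvalues] at hx
    obtain ⟨i, rfl⟩ := hx
    exact hC.eigenvalues_pos i
  nth_rewrite 3 [← cfc_id' ℝ C]
  rw [invSqrt, ← cfc_mul _ _ C (hcont _) (hcont _), ← cfc_mul _ _ C (hcont _) (hcont _),
    ← cfc_one ℝ C]
  refine cfc_congr fun x hx => ?_
  have h := hpos x hx
  have h2 : Real.sqrt x * Real.sqrt x = x := Real.mul_self_sqrt h.le
  have h3 : Real.sqrt x ≠ 0 := (Real.sqrt_pos.2 h).ne'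
  simp only [Pi.one_apply]
  field_simp
  nlinarith

/-- `H = U Σ Vᴴ` is a (full) singular value decomposition, where `Σ` is the rectangular matrix with
`ζ k` at the position `(k, k)` and zeros elsewhere. The `n` singular values `ζ k` of an
`m × n` matrix are padded by zeros if `m < n`; no order is imposed on them. -/
structure IsSVD {m n : ℕ} (H : Matrix (Fin m) (Fin n) ℂ) (U : Matrix (Fin m) (Fin m) ℂ)
    (ζ : Fin n → ℝ) (V : Matrix (Fin n) (Fin n) ℂ) : Prop where
  unitary_left : U ∈ Matrix.unitaryGroup (Fin m) ℂ
  unitary_right : V ∈ Matrix.unitaryGroup (Fin n) ℂ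
  nonneg : ∀ k, 0 ≤ ζ k
  padded : ∀ k : Fin n, m ≤ (k : ℕ) → ζ k = 0
  eq : H = U * Matrix.of (fun (i : Fin m) (k : Fin n) => if (i : ℕ) = k then (ζ k : ℂ) else 0) * Vᴴ

/-- `C = U diag(d) Uᴴ` is an eigenvalue decomposition. -/
structure IsEVD {n : ℕ} (C : Matrix (Fin n) (Fin n) ℂ) (U : Matrix (Fin n) (Fin n) ℂ)
    (d : Fin n → ℝ) : Prop where
  unitary : U ∈ Matrix.unitaryGroup (Fin n) ℂ
  eq : C = U * Matrix.diagonal (fun k => (d k : ℂ)) * Uᴴ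

/-- The span of those columns of `U` that belong to a non-zero singular value or eigenvalue. -/
def activeRange {n : ℕ} (U : Matrix (Fin n) (Fin n) ℂ) (d : Fin n → ℝ) :
    Submodule ℂ (Fin n → ℂ) :=
  Submodule.span ℂ ((fun k i => U i k) '' {k | d k ≠ 0})

/-- `(1 / ln 2 - σ² / ζ²)⁺`, which is `0` for `ζ = 0` (where `σ² / ζ² = ∞`). -/
def waterFilling (σ ζ : ℝ) : ℝ :=
  if ζ = 0 then 0 else max (1 / Real.log 2 - σ ^ 2 / ζ ^ 2) 0

namespace PointTarget

variable {Nc Ns M : ℕ} (S : PointTarget Nc Ns M)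

/-- `A(θ)` at the target angle. -/
def A : Matrix (Fin Ns) (Fin M) ℂ := response Ns M S.θ

/-- `Ȧ(θ)` at the target angle. -/
def Adot : Matrix (Fin Ns) (Fin M) ℂ := responseDot Ns M S.θ

/-- Achievable rate in bits; the determinant is real for positive semidefinite `Q`. -/
def rate (Q : Matrix (Fin M) (Fin M) ℂ) : ℝ :=
  Real.logb 2 (1 + ((1 / S.σc ^ 2 : ℝ) : ℂ) • (S.Hc * Q * S.Hcᴴ)).det.re

/-- `tr(ȦᴴȦQ) tr(AᴴAQ) - |tr(ȦᴴAQ)|²`; the CRB of the angle is defined when this is positive. -/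
def angleInfo (Q : Matrix (Fin M) (Fin M) ℂ) : ℝ :=
  (S.Adotᴴ * S.Adot * Q).trace.re * (S.Aᴴ * S.A * Q).trace.re -
    ‖(S.Adotᴴ * S.A * Q).trace‖ ^ 2

/-- The Cramér–Rao bound of the angle (meaningful when `angleInfo` is positive). -/
def CRB (Q : Matrix (Fin M) (Fin M) ℂ) : ℝ :=
  S.σs ^ 2 * (S.Aᴴ * S.A * Q).trace.re / (2 * ‖S.α‖ ^ 2 * S.L * S.angleInfo Q)

/-- The normalized threshold `2 Γ L |α|² / σs²`. -/
def Γt : ℝ := 2 * S.Γ * S.L * ‖S.α‖ ^ 2 / S.σs ^ 2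

/-- The `2 × 2` matrix that the CRB constraint requires to be positive semidefinite. -/
def crbMatrix (Q : Matrix (Fin M) (Fin M) ℂ) : Matrix (Fin 2) (Fin 2) ℂ :=
  !![(S.Adotᴴ * S.Adot * Q).trace - ((1 / S.Γt : ℝ) : ℂ), (S.Adotᴴ * S.A * Q).trace;
     (S.Aᴴ * S.Adot * Q).trace, (S.Aᴴ * S.A * Q).trace]

/-- The feasible set of the rate maximization problem. -/
def feasibleSet : Set (Matrix (Fin M) (Fin M) ℂ) :=
  {Q | Q.PosSemidef ∧ (S.crbMatrix Q).PosSemidef ∧ Q.trace.re ≤ S.P}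

/-- `Q` maximizes the rate over the feasible set. -/
def IsPrimalOptimal (Q : Matrix (Fin M) (Fin M) ℂ) : Prop :=
  Q ∈ S.feasibleSet ∧ ∀ Q' ∈ S.feasibleSet, S.rate Q' ≤ S.rate Q

/-- The Lagrangian. -/
def lagrangian (Q : Matrix (Fin M) (Fin M) ℂ) (lam : ℝ) (Z : Matrix (Fin 2) (Fin 2) ℂ) : ℝ :=
  S.rate Q - lam * (Q.trace.re - S.P) + (Z * S.crbMatrix Q).trace.re

/-- The matrix `C(λ, Z)` that collects the terms of the Lagrangian that are linear in `Q`. -/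
def C (lam : ℝ) (Z : Matrix (Fin 2) (Fin 2) ℂ) : Matrix (Fin M) (Fin M) ℂ :=
  (lam : ℂ) • 1 - (Z 0 0 • (S.Adotᴴ * S.Adot) + Z 0 1 • (S.Aᴴ * S.Adot) +
    Z 1 0 • (S.Adotᴴ * S.A) + Z 1 1 • (S.Aᴴ * S.A))

theorem lagrangian_eq (Q : Matrix (Fin M) (Fin M) ℂ) (lam : ℝ) (Z : Matrix (Fin 2) (Fin 2) ℂ) :
    S.lagrangian Q lam Z =
      S.rate Q + lam * S.P - (Z 0 0).re / S.Γt - (S.C lam Z * Q).trace.re := by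
  simp only [lagrangian, C, crbMatrix, Matrix.trace_fin_two, Matrix.mul_apply, Fin.sum_univ_two,
    Matrix.sub_mul, Matrix.add_mul, Matrix.smul_mul, Matrix.one_mul, Matrix.trace_sub,
    Matrix.trace_add, Matrix.trace_smul]
  simp
  ring

/-- The Lagrange dual function, with values in the extended reals. -/
def dualFunction (lam : ℝ) (Z : Matrix (Fin 2) (Fin 2) ℂ) : EReal :=
  ⨆ (Q : Matrix (Fin M) (Fin M) ℂ) (_ : Q.PosSemidef), (S.lagrangian Q lam Z : EReal)

/-- `(λ, Z)` minimizes the dual function over `λ ≥ 0` and `Z ⪰ 0`. -/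
def IsDualOptimal (lam : ℝ) (Z : Matrix (Fin 2) (Fin 2) ℂ) : Prop :=
  0 ≤ lam ∧ Z.PosSemidef ∧
    ∀ (lam' : ℝ) (Z' : Matrix (Fin 2) (Fin 2) ℂ), 0 ≤ lam' → Z'.PosSemidef →
      S.dualFunction lam Z ≤ S.dualFunction lam' Z'

end PointTarget

end

end ISAC

/-! One inequality carries the analysis: for positive definite `X`, `Y` of size n, log det X ≤ log
det Y + tr(Y⁻¹X) - n, with equality only for `X = Y`. It is log x ≤ x - 1 on the eigenvalues of
Y^(-1/2) X Y^(-1/2). It yields concavity of the rate, and later both optimality and uniqueness of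
water-filling (`PosDef.log_det_le_log_det_add`, `waterFilling_optimal`).

Strong duality: the feasible set is compact, so a maximizer exists. Shrinking a covariance whose CRB
is below Γ gives a Slater point; Hahn–Banach then produces a functional that is nonnegative on the
cone of strictly feasible constraint values, and such a functional is a pair (λ, Z). Weak duality
makes this pair dual optimal.

Finiteness of the dual function is tested on rays t v vᴴ, where the rate grows logarithmically and
the trace term linearly: this forces C ⪰ 0 and ker C ⊆ ker H_c, which is the range inclusion after
passing to orthogonal complements.

If C ≻ 0, the substitution Q = C^(-1/2) V W Vᴴ C^(-1/2) turns the Lagrangian, up to a constant, into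
log₂ det(I + DWD/σ²) - tr W with D diagonal, whose only maximizer is the water-filling matrix. Every
primal optimum maximizes the Lagrangian at every dual optimum, so it has this form. -/

namespace Matrix

/-! ### Positive semidefinite matrices and log det -/

section

variable {n : Type*}

theorem convex_posSemidef : Convex ℝ {Q : Matrix n n ℂ | Q.PosSemidef} := by
  intro X hX Y hY a b ha hb _
  exact (PosSemidef.smul hX ha).add (PosSemidef.smul hY hb)

theorem convex_posDef : Convex ℝ {Q : Matrix n n ℂ | Q.PosDef} := by
  rw [convex_iff_forall_pos]
  intro X hX Y hY a b ha hb _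
  exact (PosDef.smul hX ha).add (PosDef.smul hY hb)

theorem isClosed_setOf_posSemidef [Fintype n] : IsClosed {Q : Matrix n n ℂ | Q.PosSemidef} := by
  simp only [posSemidef_iff_dotProduct_mulVec, Set.ofPred_and, Set.ofPred_forall]
  refine IsClosed.inter ?_ (isClosed_iInter fun x => ?_)
  · exact isClosed_eq (by fun_prop) (by fun_prop)
  · exact isClosed_le (by fun_prop) (by fun_prop)

end

variable {n : Type*} [Fintype n] [DecidableEq n]

theorem PosDef.log_det_le_trace_sub {W : Matrix n n ℂ} (hW : W.PosDef) :
    Real.log W.det.re ≤ W.trace.re - Fintype.card n := by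
  have hd : W.det.re = ∏ i, hW.1.eigenvalues i := by
    rw [hW.1.det_eq_prod_eigenvalues]
    exact_mod_cast Complex.ofReal_re _
  have ht : W.trace.re = ∑ i, hW.1.eigenvalues i := by
    rw [hW.1.trace_eq_sum_eigenvalues]
    exact_mod_cast Complex.ofReal_re _
  rw [hd, ht, Real.log_prod fun i _ => (hW.eigenvalues_pos i).ne']
  calc ∑ i, Real.log (hW.1.eigenvalues i) ≤ ∑ i, (hW.1.eigenvalues i - 1) :=
        Finset.sum_le_sum fun i _ => Real.log_le_sub_one_of_pos (hW.eigenvalues_pos i)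
    _ = _ := by simp

theorem PosDef.eq_one_of_trace_sub_le_log_det {W : Matrix n n ℂ} (hW : W.PosDef)
    (h : W.trace.re - Fintype.card n ≤ Real.log W.det.re) : W = 1 := by
  have hd : W.det.re = ∏ i, hW.1.eigenvalues i := by
    rw [hW.1.det_eq_prod_eigenvalues]
    exact_mod_cast Complex.ofReal_re _
  have ht : W.trace.re = ∑ i, hW.1.eigenvalues i := by
    rw [hW.1.trace_eq_sum_eigenvalues]
    exact_mod_cast Complex.ofReal_re _
  rw [hd, ht, Real.log_prod fun i _ => (hW.eigenvalues_pos i).ne'] at h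
  have hone : ∀ i, hW.1.eigenvalues i = 1 := by
    intro i
    by_contra hi
    have : ∑ i, Real.log (hW.1.eigenvalues i) < ∑ i, (hW.1.eigenvalues i - 1) :=
      Finset.sum_lt_sum
        (fun i _ => Real.log_le_sub_one_of_pos (hW.eigenvalues_pos i))
        ⟨i, Finset.mem_univ i, Real.log_lt_sub_one_of_pos (hW.eigenvalues_pos i) hi⟩
    simp at this
    linarith
  rw [hW.1.spectral_theorem]
  have : hW.1.eigenvalues = fun _ => 1 := funext hone
  rw [this]
  have hdiag : (diagonal (RCLike.ofReal ∘ fun _ : n => (1 : ℝ)) : Matrix n n ℂ) = 1 := by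
    rw [← diagonal_one]
    congr 1
  rw [hdiag, map_one]

/-- Writing `A = Xᴴ * X` and cycling the trace leaves the trace of `X * B * Xᴴ`. -/
theorem PosSemidef.trace_mul_nonneg {A B : Matrix n n ℂ} (hA : A.PosSemidef)
    (hB : B.PosSemidef) : 0 ≤ (A * B).trace := by
  obtain ⟨X, rfl⟩ : ∃ X : Matrix n n ℂ, A = Xᴴ * X := by
    open scoped MatrixOrder in
    exact CStarAlgebra.nonneg_iff_eq_star_mul_self.1 hA.nonneg
  rw [Matrix.mul_assoc, Matrix.trace_mul_comm]
  exact (hB.mul_mul_conjTranspose_same X).trace_nonneg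

/-- In the spectral decomposition the entries of the unitary factor have norm at most 1, so an entry
is bounded by the sum of the eigenvalues. This is what makes the power budget a compactness
condition. -/
theorem PosSemidef.norm_apply_le_trace {Q : Matrix n n ℂ} (hQ : Q.PosSemidef) (i j : n) :
    ‖Q i j‖ ≤ Q.trace.re := by
  set U : Matrix n n ℂ := (hQ.1.eigenvectorUnitary : Matrix n n ℂ) with hU
  have hUm : U ∈ unitaryGroup n ℂ := hQ.1.eigenvectorUnitary.2
  have ht : Q.trace.re = ∑ i, hQ.1.eigenvalues i := by
    rw [hQ.1.trace_eq_sum_eigenvalues]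
    exact_mod_cast Complex.ofReal_re _
  have hQe : Q i j = ∑ k, U i k * (hQ.1.eigenvalues k : ℂ) * star (U j k) := by
    conv_lhs => rw [hQ.1.spectral_theorem, Unitary.conjStarAlgAut_apply]
    rw [Matrix.mul_apply]
    refine Finset.sum_congr rfl fun k _ => ?_
    rw [Matrix.mul_diagonal]
    rfl
  rw [hQe, ht]
  refine (norm_sum_le _ _).trans (Finset.sum_le_sum fun k _ => ?_)
  have h1 := entry_norm_bound_of_unitary hUm i k
  have h2 := entry_norm_bound_of_unitary hUm j k
  have h3 := hQ.eigenvalues_nonneg k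
  rw [norm_mul, norm_mul, norm_star, Complex.norm_real, Real.norm_of_nonneg h3]
  calc ‖U i k‖ * hQ.1.eigenvalues k * ‖U j k‖ ≤ 1 * hQ.1.eigenvalues k * 1 := by gcongr
    _ = _ := by ring

theorem isCompact_posSemidef_trace_le (c : ℝ) :
    IsCompact {Q : Matrix n n ℂ | Q.PosSemidef ∧ Q.trace.re ≤ c} := by
  have hK : IsCompact {Q : Matrix n n ℂ | ∀ i j, Q i j ∈ Metric.closedBall (0 : ℂ) c} :=
    isCompact_pi_infinite fun i => isCompact_pi_infinite fun j => isCompact_closedBall _ _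
  refine hK.of_isClosed_subset ?_ ?_
  · exact isClosed_setOf_posSemidef.inter (isClosed_le
      (f := fun Q : Matrix n n ℂ => Q.trace.re) (g := fun _ => c) (by fun_prop) (by fun_prop))
  · rintro Q ⟨hQ, ht⟩ i j
    simpa using (hQ.norm_apply_le_trace i j).trans ht

theorem PosDef.det_re_pos {X : Matrix n n ℂ} (hX : X.PosDef) : 0 < X.det.re :=
  (Complex.pos_iff.1 hX.det_pos).1

theorem PosDef.det_eq_ofReal {X : Matrix n n ℂ} (hX : X.PosDef) : X.det = (X.det.re : ℂ) :=
  Complex.ext rfl (by simpa using (Complex.pos_iff.1 hX.det_pos).2.symm)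

theorem PosDef.exists_isHermitian_mul_self_mul {Y : Matrix n n ℂ} (hY : Y.PosDef) :
    ∃ B : Matrix n n ℂ, B.IsHermitian ∧ B * B = Y⁻¹ := by
  open scoped MatrixOrder in
  exact ⟨CFC.sqrt Y⁻¹, (Matrix.nonneg_iff_posSemidef.1 (CFC.sqrt_nonneg _)).1,
    CFC.sqrt_mul_sqrt_self _ hY.inv.posSemidef.nonneg⟩

/-- The tangent inequality for the concave function `log det`, with its equality case. -/
theorem PosDef.log_det_le_log_det_add {X Y : Matrix n n ℂ} (hX : X.PosDef) (hY : Y.PosDef) :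
    Real.log X.det.re ≤ Real.log Y.det.re + ((Y⁻¹ * X).trace.re - Fintype.card n) ∧
      (Real.log Y.det.re + ((Y⁻¹ * X).trace.re - Fintype.card n) ≤ Real.log X.det.re →
        X = Y) := by
  -- `B` is Y^(-1/2); the congruence `B * X * B` reduces the claim to `Y = 1`.
  obtain ⟨B, hB, hBB⟩ := hY.exists_isHermitian_mul_self_mul
  have hYu : IsUnit Y.det := (Matrix.isUnit_iff_isUnit_det _).1 hY.isUnit
  have hBY : B * (B * Y) = 1 := by
    rw [← Matrix.mul_assoc, hBB, Matrix.nonsing_inv_mul _ hYu]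
  have hYBB : Y * B * B = 1 := by
    rw [Matrix.mul_assoc, hBB, Matrix.mul_nonsing_inv _ hYu]
  have hBu : IsUnit B := .of_mul_eq_one _ hBY
  have hW : (B * X * B).PosDef := by
    have := hX.mul_mul_conjTranspose_same (B := B) (Matrix.vecMul_injective_of_isUnit hBu)
    rwa [hB.eq] at this
  have htr : (B * X * B).trace = (Y⁻¹ * X).trace := by
    rw [Matrix.trace_mul_comm, ← Matrix.mul_assoc, hBB]
  have hdet : (B * X * B).det.re = X.det.re / Y.det.re := by
    have h1 : (B * X * B).det * Y.det = X.det := by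
      have h2 := congrArg Matrix.det hBY
      rw [Matrix.det_mul, Matrix.det_mul, Matrix.det_one] at h2
      rw [Matrix.det_mul, Matrix.det_mul]
      linear_combination X.det * h2
    rw [hX.det_eq_ofReal, hY.det_eq_ofReal, hW.det_eq_ofReal] at h1
    rw [eq_div_iff hY.det_re_pos.ne']
    exact_mod_cast h1
  have hlog : Real.log (B * X * B).det.re = Real.log X.det.re - Real.log Y.det.re := by
    rw [hdet, Real.log_div hX.det_re_pos.ne' hY.det_re_pos.ne']
  constructor
  · have := hW.log_det_le_trace_sub
    rw [htr, hlog] at this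
    linarith
  · intro h
    have h1 : B * X * B = 1 := hW.eq_one_of_trace_sub_le_log_det (by rw [htr, hlog]; linarith)
    calc X = (Y * B * B) * X * (B * (B * Y)) := by rw [hYBB, hBY]; simp
      _ = Y * B * (B * X * B) * (B * Y) := by simp only [Matrix.mul_assoc]
      _ = (Y * B * B) * Y := by rw [h1]; simp only [Matrix.mul_assoc, Matrix.mul_one]
      _ = Y := by rw [hYBB, Matrix.one_mul]

/-- Average the tangent inequalities at `T = a • X + b • Y`: the linear terms cancel because a
tr(T⁻¹X) + b tr(T⁻¹Y) = n. -/
theorem concaveOn_log_det :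
    ConcaveOn ℝ {X : Matrix n n ℂ | X.PosDef} fun X => Real.log X.det.re := by
  refine ⟨convex_posDef, fun X hX Y hY a b ha hb hab => ?_⟩
  have hT : (a • X + b • Y).PosDef := convex_posDef hX hY ha hb hab
  set T := a • X + b • Y with hTdef
  have h1 := (PosDef.log_det_le_log_det_add hX hT).1
  have h2 := (PosDef.log_det_le_log_det_add hY hT).1
  have h3 : a * (T⁻¹ * X).trace.re + b * (T⁻¹ * Y).trace.re = Fintype.card n := by
    have : (T⁻¹ * T).trace = a • (T⁻¹ * X).trace + b • (T⁻¹ * Y).trace := by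
      conv_lhs => rw [hTdef]
      simp only [Matrix.mul_add, Matrix.mul_smul, Matrix.trace_add, Matrix.trace_smul]
      rfl
    rw [Matrix.nonsing_inv_mul _ ((Matrix.isUnit_iff_isUnit_det _).1 hT.isUnit),
      Matrix.trace_one] at this
    have := congrArg Complex.re this
    simpa using this.symm
  simp only [smul_eq_mul]
  have h4 := mul_le_mul_of_nonneg_left h1 ha
  have h5 := mul_le_mul_of_nonneg_left h2 hb
  have h6 : a * (Real.log T.det.re + ((T⁻¹ * X).trace.re - Fintype.card n)) +
      b * (Real.log T.det.re + ((T⁻¹ * Y).trace.re - Fintype.card n)) = Real.log T.det.re := by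
    linear_combination (Real.log T.det.re - Fintype.card n) * hab + h3
  linarith

theorem IsHermitian.re_dotProduct_mulVec_fin_two {F : Matrix (Fin 2) (Fin 2) ℂ}
    (hF : F.IsHermitian) (x : Fin 2 → ℂ) :
    (star x ⬝ᵥ F *ᵥ x).re = (F 0 0).re * ‖x 0‖ ^ 2 + (F 1 1).re * ‖x 1‖ ^ 2 +
      2 * (star (x 0) * F 0 1 * x 1).re := by
  have h10 : F 1 0 = star (F 0 1) := (hF.apply 1 0).symm
  have i0 : (F 0 0).im = 0 := by
    have := congrArg Complex.im (hF.apply 0 0)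
    simp at this
    linarith
  have i1 : (F 1 1).im = 0 := by
    have := congrArg Complex.im (hF.apply 1 1)
    simp at this
    linarith
  rw [← Complex.normSq_eq_norm_sq, ← Complex.normSq_eq_norm_sq, Complex.normSq_apply,
    Complex.normSq_apply]
  simp [dotProduct, Matrix.mulVec, Fin.sum_univ_two, h10, i0, i1]
  ring

theorem posSemidef_fin_two_iff {F : Matrix (Fin 2) (Fin 2) ℂ} :
    F.PosSemidef ↔ F.IsHermitian ∧ 0 ≤ (F 0 0).re ∧ 0 ≤ (F 1 1).re ∧
      ‖F 0 1‖ ^ 2 ≤ (F 0 0).re * (F 1 1).re := by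
  constructor
  · intro h
    have hd := Complex.nonneg_iff.1 h.det_nonneg
    have h0 := Complex.nonneg_iff.1 (h.diag_nonneg (i := 0))
    have h1 := Complex.nonneg_iff.1 (h.diag_nonneg (i := 1))
    refine ⟨h.1, h0.1, h1.1, ?_⟩
    have h10 : F 1 0 = star (F 0 1) := (h.1.apply 1 0).symm
    rw [Matrix.det_fin_two, h10] at hd
    have h2 := hd.1
    rw [← Complex.normSq_eq_norm_sq, Complex.normSq_apply]
    simp [Complex.mul_re, ← h0.2] at h2
    linarith
  · rintro ⟨hF, h0, h1, h01⟩
    refine PosSemidef.of_dotProduct_mulVec_nonneg hF fun x => ?_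
    rw [Complex.nonneg_iff]
    refine ⟨?_, by simpa using (hF.im_star_dotProduct_mulVec_self x).symm⟩
    rw [hF.re_dotProduct_mulVec_fin_two]
    have hre : -(‖x 0‖ * ‖F 0 1‖ * ‖x 1‖) ≤ (star (x 0) * F 0 1 * x 1).re := by
      have := (abs_le.1 (Complex.abs_re_le_norm (star (x 0) * F 0 1 * x 1))).1
      simpa [norm_mul] using this
    have hF01 : ‖F 0 1‖ ≤ √(F 0 0).re * √(F 1 1).re := by
      rw [← Real.sqrt_mul h0]
      exact Real.le_sqrt_of_sq_le h01
    have hm : ‖x 0‖ * ‖F 0 1‖ * ‖x 1‖ ≤ ‖x 0‖ * (√(F 0 0).re * √(F 1 1).re) * ‖x 1‖ := by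
      gcongr
    have s0 := Real.sq_sqrt h0
    have s1 := Real.sq_sqrt h1
    -- AM–GM: the square dominates the cross term by the two diagonal terms.
    nlinarith [sq_nonneg (√(F 0 0).re * ‖x 0‖ - √(F 1 1).re * ‖x 1‖)]

end Matrix

/-! ### Lagrange multipliers by separation -/

/-- Lagrange multipliers for a concave maximization problem under Slater's condition. The
constraint is that an affine function takes its values in the closure of an open convex cone. -/
theorem ConcaveOn.exists_lagrange_multiplier {V E : Type*} [AddCommGroup V] [Module ℝ V]
    [NormedAddCommGroup E] [NormedSpace ℝ E] {s : Set V} {f : V → ℝ} {G : V → E} {K : Set E}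
    (hf : ConcaveOn ℝ s f)
    (hG : ∀ x ∈ s, ∀ y ∈ s, ∀ a b : ℝ, a + b = 1 → G (a • x + b • y) = a • G x + b • G y)
    (hKo : IsOpen K) (hKadd : ∀ u ∈ K, ∀ v ∈ K, u + v ∈ K)
    (hKsmul : ∀ c : ℝ, 0 < c → ∀ u ∈ K, c • u ∈ K) {p : ℝ}
    (hp : ∀ x ∈ s, G x ∈ K → f x ≤ p) (hs : ∃ x ∈ s, G x ∈ K) :
    ∃ φ : E →L[ℝ] ℝ, (∀ u ∈ K, 0 ≤ φ u) ∧ ∀ x ∈ s, f x + φ (G x) ≤ p := by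
  -- The pairs (gain over `p`, constraint value) that some point strictly beats. Strictness makes
  -- `A` open, and `hp` keeps the origin out of it.
  set A : Set (ℝ × E) := {w | ∃ x ∈ s, w.1 < f x - p ∧ G x - w.2 ∈ K} with hA
  have hAo : IsOpen A := by
    have : A = ⋃ x ∈ s, {w : ℝ × E | w.1 < f x - p ∧ G x - w.2 ∈ K} := by
      ext w
      simp only [hA, Set.mem_iUnion, exists_prop]
      rfl
    rw [this]
    refine isOpen_biUnion fun x _ => ?_
    exact (isOpen_lt (f := fun w : ℝ × E => w.1) (g := fun _ => f x - p) (by fun_prop)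
      (by fun_prop)).inter (hKo.preimage (f := fun w : ℝ × E => G x - w.2) (by fun_prop))
  have hAc : Convex ℝ A := by
    rw [convex_iff_forall_pos]
    rintro ⟨r, w⟩ ⟨x, hx, hr, hw⟩ ⟨r', w'⟩ ⟨y, hy, hr', hw'⟩ a b ha hb hab
    refine ⟨a • x + b • y, hf.1 hx hy ha.le hb.le hab, ?_, ?_⟩
    · have := hf.2 hx hy ha.le hb.le hab
      simp only [smul_eq_mul, Prod.fst_add, Prod.smul_fst] at this hr hr' ⊢
      have h1 := mul_lt_mul_of_pos_left hr ha
      have h2 := mul_lt_mul_of_pos_left hr' hb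
      have h3 : a * (f x - p) + b * (f y - p) = a * f x + b * f y - p := by
        linear_combination -p * hab
      linarith
    · have := hKadd _ (hKsmul a ha _ hw) _ (hKsmul b hb _ hw')
      convert this using 1
      rw [hG x hx y hy a b hab]
      simp only [Prod.snd_add, Prod.smul_snd, smul_sub]
      abel
  have h0 : (0 : ℝ × E) ∉ A := by
    rintro ⟨x, hx, hr, hw⟩
    simp only [Prod.snd_zero, Prod.fst_zero, sub_zero] at hr hw
    linarith [hp x hx hw]
  obtain ⟨ψ, hψ⟩ := geometric_hahn_banach_open_point hAc hAo h0
  set μ := ψ (1, 0) with hμ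
  set φ : E →L[ℝ] ℝ := ψ.comp (ContinuousLinearMap.inr ℝ ℝ E) with hφ
  have hsplit : ∀ r w, ψ (r, w) = r * μ + φ w := by
    intro r w
    have : ((r, w) : ℝ × E) = r • (1, 0) + (0, w) := by simp
    rw [this, map_add, map_smul]
    rfl
  have key : ∀ x ∈ s, ∀ u ∈ K, ∀ ε : ℝ, 0 < ε → (f x - p - ε) * μ + φ (G x) < φ u := by
    intro x hx u hu ε hε
    have := hψ (f x - p - ε, G x - u) ⟨x, hx, by simpa using hε, by simpa using hu⟩
    rw [hsplit, map_zero, map_sub] at this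
    linarith
  obtain ⟨x₀, hx₀, hGx₀⟩ := hs
  -- Slater's condition enters here: taking `u = G x₀` cancels the `φ` terms and rules out a
  -- separating functional with `μ = 0`.
  have hμpos : 0 < μ := by
    have h1 := key x₀ hx₀ _ hGx₀ 1 one_pos
    have h2 := hp x₀ hx₀ hGx₀
    nlinarith
  have hφK : ∀ u ∈ K, 0 ≤ φ u := by
    intro u hu
    by_contra! hneg
    set c := (f x₀ - p - 1) * μ + φ (G x₀) with hc
    have h1 := fun t ht => key x₀ hx₀ _ (hKsmul t ht u hu) 1 one_pos
    simp only [map_smul, smul_eq_mul, ← hc] at h1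
    -- `c` lies below `t * φ u` for all `t > 0`; this `t` makes the latter `-(|c| + 1)`.
    have h2 := h1 ((|c| + 1) / (-φ u)) (by have := abs_nonneg c; apply div_pos <;> linarith)
    rw [div_mul_eq_mul_div, lt_div_iff₀ (by linarith)] at h2
    nlinarith [neg_abs_le c]
  refine ⟨μ⁻¹ • φ, fun u hu => ?_, fun x hx => ?_⟩
  · simpa using mul_nonneg (inv_nonneg.2 hμpos.le) (hφK u hu)
  · have hle : (f x - p) * μ + φ (G x) ≤ 0 := by
      refine le_of_forall_pos_le_add fun ε hε => ?_
      have hu := hφK _ hGx₀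
      -- The open cone need not contain 0, so a small multiple of `G x₀` stands in for it; the `+ 1`
      -- guards against `φ (G x₀) = 0`.
      have h1 := key x hx _ (hKsmul (ε / 2 / (φ (G x₀) + 1)) (by positivity) _ hGx₀)
        (ε / 2 / μ) (by positivity)
      rw [map_smul, smul_eq_mul, sub_mul, div_mul_cancel₀ _ hμpos.ne'] at h1
      have h2 : ε / 2 / (φ (G x₀) + 1) * φ (G x₀) ≤ ε / 2 := by
        rw [div_mul_eq_mul_div, div_le_iff₀ (by linarith)]
        nlinarith
      linarith
    have h3 : f x - p + μ⁻¹ * φ (G x) ≤ 0 := by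
      have := mul_nonpos_of_nonneg_of_nonpos (inv_nonneg.2 hμpos.le) hle
      have e : μ⁻¹ * ((f x - p) * μ + φ (G x)) = f x - p + μ⁻¹ * φ (G x) := by
        field_simp
      linarith
    simp only [smul_apply, smul_eq_mul]
    linarith

/-! ### Convexity, compactness and the CRB constraint -/

namespace ISAC.PointTarget

variable {Nc Ns M : ℕ} (S : PointTarget Nc Ns M)

theorem posDef_one_add {Q : Matrix (Fin M) (Fin M) ℂ} (hQ : Q.PosSemidef) :
    (1 + ((1 / S.σc ^ 2 : ℝ) : ℂ) • (S.Hc * Q * S.Hcᴴ)).PosDef := by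
  refine Matrix.PosDef.one.add_posSemidef ((hQ.mul_mul_conjTranspose_same S.Hc).smul ?_)
  exact Complex.zero_le_real.2 (by positivity)

theorem concaveOn_rate :
    ConcaveOn ℝ {Q : Matrix (Fin M) (Fin M) ℂ | Q.PosSemidef} S.rate := by
  refine ⟨Matrix.convex_posSemidef, fun X hX Y hY a b ha hb hab => ?_⟩
  have h := Matrix.concaveOn_log_det.2 (S.posDef_one_add hX) (S.posDef_one_add hY) ha hb hab
  have e : a • (1 + ((1 / S.σc ^ 2 : ℝ) : ℂ) • (S.Hc * X * S.Hcᴴ)) +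
      b • (1 + ((1 / S.σc ^ 2 : ℝ) : ℂ) • (S.Hc * Y * S.Hcᴴ)) =
      1 + ((1 / S.σc ^ 2 : ℝ) : ℂ) • (S.Hc * (a • X + b • Y) * S.Hcᴴ) := by
    rw [Matrix.mul_add, Matrix.add_mul, Matrix.mul_smul, Matrix.mul_smul, Matrix.smul_mul,
      Matrix.smul_mul, smul_add, smul_add, smul_add, smul_comm a, smul_comm b,
      add_add_add_comm, ← add_smul, hab, one_smul]
  rw [e] at h
  have hl : 0 < Real.log 2 := Real.log_pos one_lt_two
  simp only [rate, Real.logb, smul_eq_mul] at h ⊢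
  rw [← mul_div_assoc, ← mul_div_assoc, ← add_div]
  gcongr

theorem continuousOn_rate :
    ContinuousOn S.rate {Q : Matrix (Fin M) (Fin M) ℂ | Q.PosSemidef} := by
  unfold rate Real.logb
  refine ContinuousOn.div_const (ContinuousOn.log ?_ fun Q hQ => ?_) _
  · fun_prop
  · exact (S.posDef_one_add hQ).det_re_pos.ne'

theorem continuous_crbMatrix : Continuous S.crbMatrix := by
  refine continuous_matrix fun i j => ?_
  fin_cases i <;> fin_cases j <;> simp only [crbMatrix] <;> simp <;> fun_prop

theorem crbMatrix_add_smul (X Y : Matrix (Fin M) (Fin M) ℂ) {a b : ℝ} (hab : a + b = 1) :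
    S.crbMatrix (a • X + b • Y) = a • S.crbMatrix X + b • S.crbMatrix Y := by
  have hab' : (a : ℂ) + b = 1 := by exact_mod_cast hab
  ext i j
  fin_cases i <;> fin_cases j <;> simp [crbMatrix, Matrix.mul_add]
  linear_combination (S.Γt : ℂ)⁻¹ * hab'

theorem isHermitian_crbMatrix {Q : Matrix (Fin M) (Fin M) ℂ} (hQ : Q.IsHermitian) :
    (S.crbMatrix Q).IsHermitian := by
  have h : ∀ X Y : Matrix (Fin Ns) (Fin M) ℂ,
      (starRingEnd ℂ) (Xᴴ * Y * Q).trace = (Yᴴ * X * Q).trace := by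
    intro X Y
    rw [starRingEnd_apply, ← Matrix.trace_conjTranspose, Matrix.conjTranspose_mul, Matrix.conjTranspose_mul,
      hQ.eq, Matrix.conjTranspose_conjTranspose, Matrix.trace_mul_comm]
  ext i j
  fin_cases i <;> fin_cases j <;> simp [crbMatrix, Matrix.conjTranspose_apply, h]

theorem trace_response_nonneg {Q : Matrix (Fin M) (Fin M) ℂ} (hQ : Q.PosSemidef)
    (X : Matrix (Fin Ns) (Fin M) ℂ) : 0 ≤ (Xᴴ * X * Q).trace.re :=
  (Complex.nonneg_iff.1 ((Matrix.posSemidef_conjTranspose_mul_self X).trace_mul_nonneg hQ)).1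

theorem posSemidef_crbMatrix_iff {Q : Matrix (Fin M) (Fin M) ℂ} (hQ : Q.PosSemidef) :
    (S.crbMatrix Q).PosSemidef ↔ 0 ≤ (S.Adotᴴ * S.Adot * Q).trace.re - 1 / S.Γt ∧
      0 ≤ (S.Aᴴ * S.A * Q).trace.re ∧ ‖(S.Adotᴴ * S.A * Q).trace‖ ^ 2 ≤
        ((S.Adotᴴ * S.Adot * Q).trace.re - 1 / S.Γt) * (S.Aᴴ * S.A * Q).trace.re := by
  rw [Matrix.posSemidef_fin_two_iff, and_iff_right (S.isHermitian_crbMatrix hQ.1)]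
  simp only [crbMatrix, Matrix.of_apply, Matrix.cons_val', Matrix.cons_val_zero,
    Matrix.cons_val_one, Matrix.cons_val_fin_one, Complex.sub_re, Complex.ofReal_re]

theorem convex_crb_constraint :
    Convex ℝ {Q : Matrix (Fin M) (Fin M) ℂ | (S.crbMatrix Q).PosSemidef} := by
  intro X hX Y hY a b ha hb hab
  change (S.crbMatrix _).PosSemidef
  rw [S.crbMatrix_add_smul X Y hab]
  exact Matrix.convex_posSemidef hX hY ha hb hab

theorem convex_power_constraint :
    Convex ℝ {Q : Matrix (Fin M) (Fin M) ℂ | Q.trace.re ≤ S.P} := by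
  intro X hX Y hY a b ha hb hab
  simp only [Set.mem_ofPred_eq, Matrix.trace_add, Matrix.trace_smul, Complex.add_re,
    Complex.smul_re, smul_eq_mul] at *
  calc a * X.trace.re + b * Y.trace.re ≤ a * S.P + b * S.P := by gcongr
    _ = S.P := by rw [← add_mul, hab, one_mul]

theorem convex_feasibleSet : Convex ℝ S.feasibleSet :=
  Matrix.convex_posSemidef.inter (S.convex_crb_constraint.inter S.convex_power_constraint)

theorem isCompact_feasibleSet : IsCompact S.feasibleSet := by
  have h : S.feasibleSet = {Q | Q.PosSemidef ∧ Q.trace.re ≤ S.P} ∩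
      S.crbMatrix ⁻¹' {F | F.PosSemidef} := by
    ext Q
    simp only [feasibleSet, Set.mem_inter_iff, Set.mem_ofPred_eq, Set.mem_preimage]
    tauto
  rw [h]
  exact (Matrix.isCompact_posSemidef_trace_le S.P).inter_right
    (Matrix.isClosed_setOf_posSemidef.preimage S.continuous_crbMatrix)

theorem exists_isPrimalOptimal (hne : S.feasibleSet.Nonempty) : ∃ Q, S.IsPrimalOptimal Q := by
  obtain ⟨Q, hQ, hmax⟩ := S.isCompact_feasibleSet.exists_isMaxOn hne
    (S.continuousOn_rate.mono fun Q hQ => hQ.1)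
  exact ⟨Q, hQ, fun Q' hQ' => hmax hQ'⟩

theorem Γt_pos (hα : S.α ≠ 0) (hL : 0 < S.L) (hσs : 0 < S.σs) (hΓ : 0 < S.Γ) : 0 < S.Γt := by
  have := norm_pos_iff.2 hα
  have : (0 : ℝ) < S.L := by exact_mod_cast hL
  unfold Γt
  positivity

theorem CRB_eq (hσs : 0 < S.σs) (hΓ : 0 < S.Γ) (Q : Matrix (Fin M) (Fin M) ℂ) :
    S.CRB Q = S.Γ * ((S.Aᴴ * S.A * Q).trace.re / (S.Γt * S.angleInfo Q)) := by
  unfold CRB Γt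
  field_simp

theorem posSemidef_crbMatrix_iff_CRB_le (hΓt : 0 < S.Γt) (hσs : 0 < S.σs) (hΓ : 0 < S.Γ)
    {Q : Matrix (Fin M) (Fin M) ℂ} (hQ : Q.PosSemidef) (ht : 0 < (S.Aᴴ * S.A * Q).trace.re) :
    (S.crbMatrix Q).PosSemidef ↔ 0 < S.angleInfo Q ∧ S.CRB Q ≤ S.Γ := by
  rw [S.posSemidef_crbMatrix_iff hQ, S.CRB_eq hσs hΓ, mul_le_iff_le_one_right hΓ]
  have hD : S.angleInfo Q = (S.Adotᴴ * S.Adot * Q).trace.re * (S.Aᴴ * S.A * Q).trace.re -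
    ‖(S.Adotᴴ * S.A * Q).trace‖ ^ 2 := rfl
  have hx := sq_nonneg ‖(S.Adotᴴ * S.A * Q).trace‖
  generalize (S.Adotᴴ * S.Adot * Q).trace.re = d at *
  generalize (S.Aᴴ * S.A * Q).trace.re = t at *
  generalize ‖(S.Adotᴴ * S.A * Q).trace‖ ^ 2 = x at *
  generalize S.angleInfo Q = D at *
  -- Expanding the determinant condition gives the CRB bound; the sign of the first diagonal entry
  -- then comes for free from `0 < t`.
  have hkey : x ≤ (d - 1 / S.Γt) * t ↔ t / S.Γt ≤ D := by
    rw [hD, sub_mul, one_div_mul_eq_div]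
    constructor <;> intro h <;> linarith
  constructor
  · rintro ⟨-, -, h⟩
    have h' := hkey.1 h
    have hD0 : 0 < D := (by positivity : 0 < t / S.Γt).trans_le h'
    exact ⟨hD0, (div_le_one (by positivity)).2 ((div_le_iff₀' hΓt).1 h')⟩
  · rintro ⟨hD0, h⟩
    have h' := hkey.2 ((div_le_iff₀' hΓt).2 ((div_le_one (by positivity)).1 h))
    exact ⟨nonneg_of_mul_nonneg_left (hx.trans h') ht, ht.le, h'⟩

/-! ### Slater point and strong duality -/

/-- The constraint function of the rate maximization problem, in real coordinates. -/
noncomputable def constraints (Q : Matrix (Fin M) (Fin M) ℂ) : ℝ × ℝ × ℝ × ℂ :=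
  (S.P - Q.trace.re, (S.crbMatrix Q 0 0).re, (S.crbMatrix Q 1 1).re, S.crbMatrix Q 0 1)

/-- The open cone of strictly feasible constraint values. -/
def strictCone : Set (ℝ × ℝ × ℝ × ℂ) :=
  {e | 0 < e.1 ∧ 0 < e.2.1 ∧ 0 < e.2.2.1 ∧ ‖e.2.2.2‖ ^ 2 < e.2.1 * e.2.2.1}

theorem isOpen_strictCone : IsOpen strictCone := by
  simp only [strictCone, Set.ofPred_and]
  refine .inter (isOpen_lt ?_ ?_) (.inter (isOpen_lt ?_ ?_)
    (.inter (isOpen_lt ?_ ?_) (isOpen_lt ?_ ?_))) <;> fun_prop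

theorem add_mem_strictCone {u v : ℝ × ℝ × ℝ × ℂ} (hu : u ∈ strictCone) (hv : v ∈ strictCone) :
    u + v ∈ strictCone := by
  obtain ⟨s, x, y, z⟩ := u
  obtain ⟨s', x', y', z'⟩ := v
  obtain ⟨hs, hx, hy, hz⟩ := hu
  obtain ⟨hs', hx', hy', hz'⟩ := hv
  refine ⟨add_pos hs hs', add_pos hx hx', add_pos hy hy', ?_⟩
  simp only [Prod.mk_add_mk] at *
  have h1 : ‖z + z'‖ ^ 2 ≤ (‖z‖ + ‖z'‖) ^ 2 := by
    gcongr
    exact norm_add_le _ _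
  -- After squaring, this is AM–GM for x y' and x' y.
  have h2 : 2 * (‖z‖ * ‖z'‖) ≤ x * y' + x' * y := by
    refine abs_le_of_sq_le_sq' ?_ (by positivity) |>.2
    have h3 : ‖z‖ ^ 2 * ‖z'‖ ^ 2 ≤ (x * y) * (x' * y') := by gcongr
    nlinarith [sq_nonneg (x * y' - x' * y)]
  nlinarith

theorem smul_mem_strictCone {c : ℝ} (hc : 0 < c) {u : ℝ × ℝ × ℝ × ℂ} (hu : u ∈ strictCone) :
    c • u ∈ strictCone := by
  obtain ⟨s, x, y, z⟩ := u
  obtain ⟨hs, hx, hy, hz⟩ := hu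
  simp only at *
  refine ⟨mul_pos hc hs, mul_pos hc hx, mul_pos hc hy, ?_⟩
  simp only [Prod.smul_mk, norm_smul, smul_eq_mul, mul_pow, Real.norm_eq_abs, sq_abs]
  nlinarith [mul_lt_mul_of_pos_left hz (pow_pos hc 2)]

theorem mem_feasibleSet_of_constraints_mem {Q : Matrix (Fin M) (Fin M) ℂ} (hQ : Q.PosSemidef)
    (h : S.constraints Q ∈ strictCone) : Q ∈ S.feasibleSet := by
  obtain ⟨h1, h2, h3, h4⟩ := h
  exact ⟨hQ, Matrix.posSemidef_fin_two_iff.2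
    ⟨S.isHermitian_crbMatrix hQ.1, h2.le, h3.le, h4.le⟩, (sub_pos.1 h1).le⟩

theorem exists_strictly_feasible (hσs : 0 < S.σs) (hP : 0 < S.P) (hΓ : 0 < S.Γ)
    (hΓt : 0 < S.Γt) (hCRB : ∃ Q : Matrix (Fin M) (Fin M) ℂ, Q.PosSemidef ∧ Q.trace.re ≤ S.P ∧
      0 < S.angleInfo Q ∧ S.CRB Q < S.Γ) :
    ∃ Q : Matrix (Fin M) (Fin M) ℂ, Q.PosSemidef ∧ S.constraints Q ∈ strictCone := by
  obtain ⟨Q, hQ, hQP, hD0, hlt⟩ := hCRB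
  rw [S.CRB_eq hσs hΓ, mul_lt_iff_lt_one_right hΓ] at hlt
  -- Scaling `Q` by `c` divides its CRB by `c`. With CRB/Γ < c < 1 the CRB stays below Γ, while the
  -- power constraint becomes strict.
  obtain ⟨c, hc1, hc2⟩ := exists_between hlt
  have hd0 := trace_response_nonneg hQ S.Adot
  have ht0 := trace_response_nonneg hQ S.A
  have hc0 : 0 < c := lt_of_le_of_lt (by positivity) hc1
  refine ⟨c • Q, hQ.smul hc0.le, ?_⟩
  have hD : S.angleInfo Q = (S.Adotᴴ * S.Adot * Q).trace.re * (S.Aᴴ * S.A * Q).trace.re -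
    ‖(S.Adotᴴ * S.A * Q).trace‖ ^ 2 := rfl
  have hx := sq_nonneg ‖(S.Adotᴴ * S.A * Q).trace‖
  have ht : 0 < (S.Aᴴ * S.A * Q).trace.re := by
    refine lt_of_le_of_ne ht0 fun h => ?_
    rw [← h, mul_zero] at hD
    linarith
  rw [div_lt_iff₀ (by positivity)] at hc1
  have hc1' : (S.Aᴴ * S.A * Q).trace.re / S.Γt < c * S.angleInfo Q := by
    rw [div_lt_iff₀' hΓt]
    linarith
  have hkey : c * ‖(S.Adotᴴ * S.A * Q).trace‖ ^ 2 <
      (c * (S.Adotᴴ * S.Adot * Q).trace.re - 1 / S.Γt) * (S.Aᴴ * S.A * Q).trace.re := by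
    rw [sub_mul, one_div_mul_eq_div]
    rw [hD] at hc1'
    linarith
  have hpos : 0 < c * (S.Adotᴴ * S.Adot * Q).trace.re - 1 / S.Γt :=
    pos_of_mul_pos_left (lt_of_le_of_lt (by positivity) hkey) ht.le
  simp only [strictCone, constraints, crbMatrix, Set.mem_ofPred_eq, Matrix.mul_smul,
    Matrix.trace_smul, Complex.smul_re, smul_eq_mul, Matrix.of_apply, Matrix.cons_val',
    Matrix.cons_val_zero, Matrix.cons_val_one, Matrix.cons_val_fin_one, Complex.sub_re,
    Complex.ofReal_re, norm_smul, Real.norm_of_nonneg hc0.le]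
  refine ⟨?_, hpos, mul_pos hc0 ht, ?_⟩
  · have := (Complex.nonneg_iff.1 hQ.trace_nonneg).1
    nlinarith
  · nlinarith [mul_lt_mul_of_pos_left hkey hc0]

theorem rate_le_lagrangian {Q : Matrix (Fin M) (Fin M) ℂ} (hQ : Q ∈ S.feasibleSet) {lam : ℝ}
    (hlam : 0 ≤ lam) {Z : Matrix (Fin 2) (Fin 2) ℂ} (hZ : Z.PosSemidef) :
    S.rate Q ≤ S.lagrangian Q lam Z := by
  have h1 := (Complex.nonneg_iff.1 (hZ.trace_mul_nonneg hQ.2.1)).1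
  have h2 := mul_nonneg hlam (sub_nonneg.2 hQ.2.2)
  unfold lagrangian
  linarith

theorem lagrangian_le_dualFunction {Q : Matrix (Fin M) (Fin M) ℂ} (hQ : Q.PosSemidef) (lam : ℝ)
    (Z : Matrix (Fin 2) (Fin 2) ℂ) : (S.lagrangian Q lam Z : EReal) ≤ S.dualFunction lam Z :=
  le_iSup₂ (f := fun (Q : Matrix (Fin M) (Fin M) ℂ) (_ : Q.PosSemidef) =>
    (S.lagrangian Q lam Z : EReal)) Q hQ

theorem exists_posSemidef_of_nonneg_on_strictCone {φ : ℝ × ℝ × ℝ × ℂ →L[ℝ] ℝ}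
    (hφ : ∀ u ∈ strictCone, 0 ≤ φ u) :
    ∃ (lam : ℝ) (Z : Matrix (Fin 2) (Fin 2) ℂ), 0 ≤ lam ∧ Z.PosSemidef ∧
      ∀ (s : ℝ) (F : Matrix (Fin 2) (Fin 2) ℂ), F.IsHermitian →
        φ (s, (F 0 0).re, (F 1 1).re, F 0 1) = lam * s + (Z * F).trace.re := by
  set l := φ (1, 0, 0, 0) with hl
  set c₁ := φ (0, 1, 0, 0) with hc₁
  set c₂ := φ (0, 0, 1, 0) with hc₂
  -- Chosen so that the restriction of `φ` to the complex coordinate is z ↦ Re(w z).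
  set w : ℂ := ⟨φ (0, 0, 0, 1), -φ (0, 0, 0, Complex.I)⟩ with hw
  have hsplit : ∀ s x y z, φ (s, x, y, z) = l * s + c₁ * x + c₂ * y + (w * z).re := by
    intro s x y z
    have : ((s, x, y, z) : ℝ × ℝ × ℝ × ℂ) = s • (1, 0, 0, 0) + x • (0, 1, 0, 0) +
        y • (0, 0, 1, 0) + z.re • (0, 0, 0, 1) + z.im • (0, 0, 0, Complex.I) := by
      simp
    rw [this]
    simp only [map_add, map_smul, smul_eq_mul, ← hl, ← hc₁, ← hc₂, Complex.mul_re, hw]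
    ring
  -- Nonnegativity passes to the closed cone by shifting the real coordinates by ε → 0.
  have hcone : ∀ s x y z, 0 ≤ s → 0 ≤ x → 0 ≤ y → ‖z‖ ^ 2 ≤ x * y → 0 ≤ φ (s, x, y, z) := by
    intro s x y z hs hx hy hz
    have hlim : Filter.Tendsto (fun ε : ℝ => φ (s + ε, x + ε, y + ε, z))
        (nhdsWithin 0 (Set.Ioi 0)) (nhds (φ (s + 0, x + 0, y + 0, z))) := by
      refine Filter.Tendsto.mono_left (Continuous.tendsto (by fun_prop) 0) nhdsWithin_le_nhds
    simp only [add_zero] at hlim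
    refine ge_of_tendsto hlim ?_
    filter_upwards [self_mem_nhdsWithin] with ε hε
    have hε : 0 < ε := hε
    refine hφ _ ⟨by simp only; positivity, by simp only; positivity, by simp only; positivity, ?_⟩
    simp only
    nlinarith [mul_nonneg hx hε.le, mul_nonneg hy hε.le, mul_pos hε hε]
  -- The off-diagonal part is halved since tr(ZF) counts it twice.
  set Z : Matrix (Fin 2) (Fin 2) ℂ := !![(c₁ : ℂ), star w / 2; w / 2, (c₂ : ℂ)] with hZdef
  have hZ : Z.IsHermitian := by
    ext i j
    fin_cases i <;> fin_cases j <;> simp [hZdef]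
  refine ⟨l, Z, ?_, ?_, fun s F hF => ?_⟩
  · have := hcone 1 0 0 0 zero_le_one le_rfl le_rfl (by simp)
    rw [hsplit] at this
    simpa using this
  · refine Matrix.PosSemidef.of_dotProduct_mulVec_nonneg hZ fun x => ?_
    rw [Complex.nonneg_iff]
    refine ⟨?_, by simpa using (hZ.im_star_dotProduct_mulVec_self x).symm⟩
    rw [hZ.re_dotProduct_mulVec_fin_two]
    -- The rank-one matrix x xᴴ lies on the boundary of the cone, and `φ` there is the quadratic
    -- form of `Z` at `x`.
    have := hcone 0 (‖x 0‖ ^ 2) (‖x 1‖ ^ 2) (x 0 * star (x 1)) le_rfl (by positivity)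
      (by positivity) (by rw [norm_mul, norm_star, mul_pow])
    rw [hsplit] at this
    convert this using 1
    simp [hZdef]
    ring
  · rw [hsplit]
    have h10 : F 1 0 = star (F 0 1) := (hF.apply 1 0).symm
    rw [Matrix.trace_fin_two, Matrix.mul_apply, Matrix.mul_apply, Fin.sum_univ_two,
      Fin.sum_univ_two, h10]
    simp [hZdef]
    ring

theorem exists_isPrimalOptimal_and_multipliers
    (hs : ∃ Q : Matrix (Fin M) (Fin M) ℂ, Q.PosSemidef ∧ S.constraints Q ∈ strictCone) :
    ∃ (Q : Matrix (Fin M) (Fin M) ℂ) (lam : ℝ) (Z : Matrix (Fin 2) (Fin 2) ℂ),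
      S.IsPrimalOptimal Q ∧ 0 ≤ lam ∧ Z.PosSemidef ∧
        ∀ Q' : Matrix (Fin M) (Fin M) ℂ, Q'.PosSemidef → S.lagrangian Q' lam Z ≤ S.rate Q := by
  obtain ⟨Q₀, hQ₀, hQ₀K⟩ := hs
  obtain ⟨Q, hQ⟩ := S.exists_isPrimalOptimal
    ⟨Q₀, S.mem_feasibleSet_of_constraints_mem hQ₀ hQ₀K⟩
  have haff : ∀ X ∈ {Q : Matrix (Fin M) (Fin M) ℂ | Q.PosSemidef},
      ∀ Y ∈ {Q : Matrix (Fin M) (Fin M) ℂ | Q.PosSemidef}, ∀ a b : ℝ, a + b = 1 →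
      S.constraints (a • X + b • Y) = a • S.constraints X + b • S.constraints Y := by
    intro X _ Y _ a b hab
    simp only [constraints, S.crbMatrix_add_smul X Y hab, Matrix.trace_add, Matrix.trace_smul,
      Matrix.add_apply, Matrix.smul_apply, Complex.add_re, Complex.smul_re, smul_eq_mul,
      Prod.smul_mk, Prod.mk_add_mk]
    congr 1
    linear_combination -S.P * hab
  obtain ⟨φ, hφ, hφQ⟩ := S.concaveOn_rate.exists_lagrange_multiplier (G := S.constraints)
    (K := strictCone) (p := S.rate Q) haff isOpen_strictCone
    (fun u hu v hv => add_mem_strictCone hu hv) (fun c hc u hu => smul_mem_strictCone hc hu)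
    (fun Q' hQ' h => hQ.2 Q' (S.mem_feasibleSet_of_constraints_mem hQ' h)) ⟨Q₀, hQ₀, hQ₀K⟩
  obtain ⟨lam, Z, hlam, hZ, h⟩ := exists_posSemidef_of_nonneg_on_strictCone hφ
  refine ⟨Q, lam, Z, hQ, hlam, hZ, fun Q' hQ' => ?_⟩
  have h1 := hφQ Q' hQ'
  rw [constraints, h _ _ (S.isHermitian_crbMatrix hQ'.1)] at h1
  unfold lagrangian
  linarith

theorem isDualOptimal_of_lagrangian_le {Q : Matrix (Fin M) (Fin M) ℂ} (hQ : Q ∈ S.feasibleSet)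
    {lam : ℝ} {Z : Matrix (Fin 2) (Fin 2) ℂ} (hlam : 0 ≤ lam) (hZ : Z.PosSemidef)
    (h : ∀ Q' : Matrix (Fin M) (Fin M) ℂ, Q'.PosSemidef → S.lagrangian Q' lam Z ≤ S.rate Q) :
    S.IsDualOptimal lam Z ∧ S.dualFunction lam Z = (S.rate Q : EReal) := by
  have hweak : ∀ (lam' : ℝ) (Z' : Matrix (Fin 2) (Fin 2) ℂ), 0 ≤ lam' → Z'.PosSemidef →
      (S.rate Q : EReal) ≤ S.dualFunction lam' Z' := fun lam' Z' hlam' hZ' =>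
    (EReal.coe_le_coe_iff.2 (S.rate_le_lagrangian hQ hlam' hZ')).trans
      (S.lagrangian_le_dualFunction hQ.1 lam' Z')
  have hle : S.dualFunction lam Z ≤ (S.rate Q : EReal) :=
    iSup₂_le fun Q' hQ' => EReal.coe_le_coe_iff.2 (h Q' hQ')
  exact ⟨⟨hlam, hZ, fun lam' Z' hlam' hZ' => hle.trans (hweak lam' Z' hlam' hZ')⟩,
    le_antisymm hle (hweak lam Z hlam hZ)⟩

end ISAC.PointTarget

/-! ### Water-filling on parallel channels -/

namespace ISAC

/-- The rate sees the rectangular factor only through `Tᴴ * T`; for columns beyond the `m`-th,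
`padded` makes both sides vanish. -/
theorem IsSVD.exists_eq_mul {m n : ℕ} {H : Matrix (Fin m) (Fin n) ℂ}
    {U : Matrix (Fin m) (Fin m) ℂ} {ζ : Fin n → ℝ} {V : Matrix (Fin n) (Fin n) ℂ}
    (h : IsSVD H U ζ V) :
    ∃ T : Matrix (Fin m) (Fin n) ℂ, H = U * T * Vᴴ ∧
      Tᴴ * T = Matrix.diagonal (fun k => (ζ k : ℂ)) * Matrix.diagonal (fun k => (ζ k : ℂ)) := by
  refine ⟨_, h.eq, ?_⟩
  rw [Matrix.diagonal_mul_diagonal]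
  ext k l
  rw [Matrix.mul_apply, Matrix.diagonal_apply]
  simp only [Matrix.conjTranspose_apply, Matrix.of_apply]
  by_cases hk : (k : ℕ) < m
  · rw [Finset.sum_eq_single (⟨k, hk⟩ : Fin m)]
    · by_cases hkl : k = l
      · subst hkl
        simp
      · simp [hkl, Fin.ext_iff.not.1 hkl]
    · intro i _ hi
      have : (i : ℕ) ≠ k := fun h => hi (Fin.ext h)
      simp [this]
    · simp
  · rw [Finset.sum_eq_zero]
    · simp [h.padded k (not_lt.1 hk)]
    · intro i _
      have : (i : ℕ) ≠ k := by omega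
      simp [this]

/-- The optimality conditions of scalar water-filling. -/
theorem waterFilling_spec {σ : ℝ} (hσ : 0 < σ) (ζ : ℝ) :
    0 ≤ waterFilling σ ζ ∧
      ζ ^ 2 / σ ^ 2 ≤ (1 + ζ ^ 2 / σ ^ 2 * waterFilling σ ζ) * Real.log 2 ∧
      (waterFilling σ ζ ≠ 0 →
        ζ ^ 2 / σ ^ 2 = (1 + ζ ^ 2 / σ ^ 2 * waterFilling σ ζ) * Real.log 2) := by
  have hl : 0 < Real.log 2 := Real.log_pos one_lt_two
  unfold waterFilling
  split_ifs with hζ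
  · simp [hζ, hl.le]
  · have ha : 0 < ζ ^ 2 / σ ^ 2 := by positivity
    have hinv : σ ^ 2 / ζ ^ 2 = 1 / (ζ ^ 2 / σ ^ 2) := by rw [one_div_div]
    rw [hinv]
    generalize ζ ^ 2 / σ ^ 2 = a at *
    refine ⟨le_max_right _ _, ?_⟩
    rcases le_total (1 / Real.log 2 - 1 / a) 0 with h | h
    · rw [max_eq_right h]
      have := (one_div_le_one_div hl ha).1 (sub_nonpos.1 h)
      simpa using this
    · rw [max_eq_left h]
      have : a = (1 + a * (1 / Real.log 2 - 1 / a)) * Real.log 2 := by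
        field_simp
        ring
      exact ⟨this.le, fun _ => this⟩

theorem _root_.Matrix.PosSemidef.apply_eq_zero_of_diag_eq_zero {n : Type*} [Fintype n]
    [DecidableEq n] {W : Matrix n n ℂ} (hW : W.PosSemidef) {k : n} (hk : W k k = 0) (l : n) :
    W k l = 0 ∧ W l k = 0 := by
  have h := (hW.dotProduct_mulVec_zero_iff (Pi.single k 1)).1 (by simp [hk])
  have h1 : W l k = 0 := by simpa using congrFun h l
  refine ⟨?_, h1⟩
  rw [← hW.1.apply k l, h1, star_zero]

/-- Water-filling maximizes the rate of parallel channels with a linear power price. -/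
theorem waterFilling_optimal {n : Type*} [Fintype n] [DecidableEq n] {σ : ℝ} (hσ : 0 < σ)
    (ζ : n → ℝ) {W : Matrix n n ℂ} (hW : W.PosSemidef) {D P : Matrix n n ℂ}
    (hD : D = Matrix.diagonal fun k => (ζ k : ℂ))
    (hP : P = Matrix.diagonal fun k => (waterFilling σ (ζ k) : ℂ)) :
    Real.logb 2 (1 + ((1 / σ ^ 2 : ℝ) : ℂ) • (D * W * D)).det.re - W.trace.re ≤
      Real.logb 2 (1 + ((1 / σ ^ 2 : ℝ) : ℂ) • (D * P * D)).det.re - P.trace.re ∧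
    (Real.logb 2 (1 + ((1 / σ ^ 2 : ℝ) : ℂ) • (D * P * D)).det.re - P.trace.re ≤
      Real.logb 2 (1 + ((1 / σ ^ 2 : ℝ) : ℂ) • (D * W * D)).det.re - W.trace.re → W = P) := by
  have hl : 0 < Real.log 2 := Real.log_pos one_lt_two
  have hpos : ∀ {W : Matrix n n ℂ}, W.PosSemidef →
      (1 + ((1 / σ ^ 2 : ℝ) : ℂ) • (D * W * D)).PosDef := by
    intro W hW
    have hDs : Dᴴ = D := by
      rw [hD, Matrix.diagonal_conjTranspose]
      congr 1
      ext
      simp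
    have := hW.mul_mul_conjTranspose_same D
    rw [hDs] at this
    exact Matrix.PosDef.one.add_posSemidef
      (this.smul (Complex.zero_le_real.2 (by positivity)))
  have hPpos : P.PosSemidef := by
    rw [hP]
    refine Matrix.PosSemidef.diagonal fun k => ?_
    exact Complex.zero_le_real.2 (waterFilling_spec hσ (ζ k)).1
  set p : n → ℝ := fun k => waterFilling σ (ζ k) with hp
  set a : n → ℝ := fun k => ζ k ^ 2 / σ ^ 2 with ha
  set y : n → ℝ := fun k => 1 + a k * p k with hy
  have ha0 : ∀ k, 0 ≤ a k := fun k => by positivity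
  have hp0 : ∀ k, 0 ≤ p k := fun k => (waterFilling_spec hσ (ζ k)).1
  have hy0 : ∀ k, 0 < y k := fun k => by
    have := mul_nonneg (ha0 k) (hp0 k)
    simp only [hy]
    linarith
  -- The derivative of log₂(1 + a p) - p at the water-filling level. `hb0` and `hbp` are the KKT
  -- conditions: nonpositive slope, and complementary slackness.
  set b : n → ℝ := fun k => a k / (y k * Real.log 2) - 1 with hb
  have hb0 : ∀ k, b k ≤ 0 := fun k => by
    have h := (waterFilling_spec hσ (ζ k)).2.1
    have := (div_le_one (mul_pos (hy0 k) hl)).2 h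
    simp only [hb]
    linarith
  have hbp : ∀ k, b k * p k = 0 := fun k => by
    by_cases h : p k = 0
    · rw [h, mul_zero]
    · have h1 := (waterFilling_spec hσ (ζ k)).2.2 h
      have : a k / (y k * Real.log 2) = 1 := (div_eq_one_iff_eq (mul_pos (hy0 k) hl).ne').2 h1
      simp only [hb]
      rw [this]
      ring
  have hY : 1 + ((1 / σ ^ 2 : ℝ) : ℂ) • (D * P * D) = Matrix.diagonal fun k => (y k : ℂ) := by
    rw [hD, hP, Matrix.diagonal_mul_diagonal, Matrix.diagonal_mul_diagonal, ← Matrix.diagonal_smul,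
      ← Matrix.diagonal_one, Matrix.diagonal_add]
    congr 1
    ext k
    simp [hy, ha, hp]
    ring
  have hYinv : (Matrix.diagonal fun k => (y k : ℂ))⁻¹ =
      Matrix.diagonal fun k => (((y k)⁻¹ : ℝ) : ℂ) := by
    refine Matrix.inv_eq_right_inv ?_
    rw [Matrix.diagonal_mul_diagonal, ← Matrix.diagonal_one]
    congr 1
    ext k
    rw [← Complex.ofReal_mul, mul_inv_cancel₀ (hy0 k).ne', Complex.ofReal_one]
  have htr : ((1 + ((1 / σ ^ 2 : ℝ) : ℂ) • (D * P * D))⁻¹ *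
      (1 + ((1 / σ ^ 2 : ℝ) : ℂ) • (D * W * D))).trace.re - Fintype.card n =
      Real.log 2 * ∑ k, (b k + 1) * ((W k k).re - p k) := by
    rw [hY, hYinv, Matrix.trace, Complex.re_sum, Finset.mul_sum, ← Finset.card_univ,
      Finset.card_eq_sum_ones, Nat.cast_sum, ← Finset.sum_sub_distrib]
    refine Finset.sum_congr rfl fun k _ => ?_
    rw [Matrix.diag_apply, Matrix.diagonal_mul, Complex.re_ofReal_mul, Matrix.add_apply,
      Matrix.one_apply_eq, Matrix.smul_apply, smul_eq_mul, Complex.add_re, Complex.re_ofReal_mul,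
      hD, Matrix.mul_diagonal, Matrix.diagonal_mul, mul_assoc, Complex.re_ofReal_mul,
      Complex.re_mul_ofReal, Complex.one_re, Nat.cast_one]
    have h1 : (y k)⁻¹ * (1 + 1 / σ ^ 2 * (ζ k * ((W k k).re * ζ k))) - 1 =
        (1 + a k * (W k k).re - y k) / y k := by
      have := (hy0 k).ne'
      simp only [ha]
      field_simp
    rw [h1]
    have h2 : 1 + a k * (W k k).re - y k = a k * ((W k k).re - p k) := by
      simp only [hy]
      ring
    rw [h2]
    have := (hy0 k).ne'
    simp only [hb]
    field_simp
    ring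
  have hsum : ∑ k, (b k + 1) * ((W k k).re - p k) =
      ∑ k, b k * (W k k).re + (W.trace.re - P.trace.re) := by
    rw [Matrix.trace, Matrix.trace, Complex.re_sum, Complex.re_sum, ← Finset.sum_sub_distrib,
      ← Finset.sum_add_distrib]
    refine Finset.sum_congr rfl fun k _ => ?_
    have : (P k k).re = p k := by simp [hP, hp]
    rw [Matrix.diag_apply, Matrix.diag_apply, this]
    linear_combination -hbp k
  have hdiag : ∀ k, 0 ≤ (W k k).re := fun k => (Complex.nonneg_iff.1 hW.diag_nonneg).1
  have hbw : ∀ k, b k * (W k k).re ≤ 0 := fun k =>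
    mul_nonpos_of_nonpos_of_nonneg (hb0 k) (hdiag k)
  -- By the tangent inequality at the water-filling point, this sum bounds the excess of the
  -- objective at `W`.
  have hbw' : ∑ k, b k * (W k k).re ≤ 0 := Finset.sum_nonpos fun k _ => hbw k
  obtain ⟨hle, heq⟩ := Matrix.PosDef.log_det_le_log_det_add (hpos hW) (hpos hPpos)
  rw [htr, hsum] at hle heq
  generalize hX : (1 + ((1 / σ ^ 2 : ℝ) : ℂ) • (D * W * D)) = X at *
  generalize hYY : (1 + ((1 / σ ^ 2 : ℝ) : ℂ) • (D * P * D)) = Y at *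
  have hle' : Real.logb 2 X.det.re ≤ Real.logb 2 Y.det.re +
      (∑ k, b k * (W k k).re + (W.trace.re - P.trace.re)) := by
    simp only [Real.logb]
    rw [div_le_iff₀ hl, add_mul, div_mul_cancel₀ _ hl.ne', mul_comm _ (Real.log 2)]
    exact hle
  refine ⟨by linarith, fun hge => ?_⟩
  have hzero : ∑ k, b k * (W k k).re = 0 := by linarith
  have hXY : X = Y := by
    refine heq ?_
    have h1 : Real.logb 2 Y.det.re + (∑ k, b k * (W k k).re + (W.trace.re - P.trace.re)) ≤
        Real.logb 2 X.det.re := by linarith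
    simp only [Real.logb] at h1
    rw [le_div_iff₀ hl, add_mul, div_mul_cancel₀ _ hl.ne', mul_comm _ (Real.log 2)] at h1
    exact h1
  have hbwk : ∀ k, b k * (W k k).re = 0 := fun k =>
    (Finset.sum_eq_zero_iff_of_nonpos fun k _ => hbw k).1 hzero k (Finset.mem_univ k)
  -- `D * W * D` does not see the rows with `ζ k = 0`. There `b k = -1`, so equality forces the
  -- diagonal entry, and with it the row and column, to vanish.
  have hrow : ∀ k, ζ k = 0 → p k = 0 ∧ W k k = 0 := by
    intro k hk
    refine ⟨by simp [hp, waterFilling, hk], ?_⟩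
    have h1 : b k = -1 := by simp [hb, ha, hk]
    have h2 := hbwk k
    rw [h1] at h2
    refine Complex.ext (by simpa using h2) ?_
    exact (Complex.nonneg_iff.1 hW.diag_nonneg).2.symm
  ext k l
  by_cases hk : ζ k = 0
  · rw [(hW.apply_eq_zero_of_diag_eq_zero (hrow k hk).2 l).1, hP, Matrix.diagonal_apply]
    have := (hrow k hk).1
    simp only [hp] at this
    simp [this]
  by_cases hl' : ζ l = 0
  · rw [(hW.apply_eq_zero_of_diag_eq_zero (hrow l hl').2 k).2, hP, Matrix.diagonal_apply]
    have := (hrow l hl').1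
    simp only [hp] at this
    split_ifs with hkl
    · subst hkl
      simp [this]
    · rfl
  have hσ' : ((1 / σ ^ 2 : ℝ) : ℂ) ≠ 0 := by
    rw [Complex.ofReal_ne_zero]
    positivity
  have h1 : D * W * D = D * P * D := by
    have : ((1 / σ ^ 2 : ℝ) : ℂ) • (D * W * D) = ((1 / σ ^ 2 : ℝ) : ℂ) • (D * P * D) :=
      add_left_cancel (hX.trans (hXY.trans hYY.symm))
    exact smul_right_injective _ hσ' this
  have h2 := congrFun (congrFun h1 k) l
  simp only [hD, Matrix.mul_diagonal, Matrix.diagonal_mul] at h2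
  have hk' : (ζ k : ℂ) ≠ 0 := by exact_mod_cast hk
  have hl'' : (ζ l : ℂ) ≠ 0 := by exact_mod_cast hl'
  exact mul_left_cancel₀ hk' (mul_right_cancel₀ hl'' h2)

end ISAC

/-! ### Finiteness of the dual function -/

namespace ISAC

namespace PointTarget

variable {Nc Ns M : ℕ} (S : PointTarget Nc Ns M)

theorem isHermitian_C (lam : ℝ) {Z : Matrix (Fin 2) (Fin 2) ℂ} (hZ : Z.IsHermitian) :
    (S.C lam Z).IsHermitian := by
  have h := fun i j => hZ.apply i j
  rw [Matrix.IsHermitian, C]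
  simp only [Matrix.conjTranspose_sub, Matrix.conjTranspose_add, Matrix.conjTranspose_smul,
    Matrix.conjTranspose_mul, Matrix.conjTranspose_conjTranspose, Matrix.conjTranspose_one, h]
  rw [Complex.star_def, Complex.conj_ofReal]
  abel

theorem rate_smul_vecMulVec (t : ℝ) (v : Fin M → ℂ) :
    S.rate ((t : ℂ) • Matrix.vecMulVec v (star v)) =
      Real.logb 2 (1 + t * ((star (S.Hc *ᵥ v) ⬝ᵥ (S.Hc *ᵥ v)).re / S.σc ^ 2)) := by
  have h : ((1 / S.σc ^ 2 : ℝ) : ℂ) •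
      (S.Hc * ((t : ℂ) • Matrix.vecMulVec v (star v)) * S.Hcᴴ) =
      Matrix.replicateCol Unit (((t / S.σc ^ 2 : ℝ) : ℂ) • (S.Hc *ᵥ v)) *
        Matrix.replicateRow Unit (star (S.Hc *ᵥ v)) := by
    rw [← Matrix.vecMulVec_eq, Matrix.mul_smul, Matrix.smul_mul, Matrix.mul_vecMulVec,
      Matrix.vecMulVec_mul, ← Matrix.star_mulVec, smul_smul, Matrix.smul_vecMulVec]
    congr 1
    push_cast
    ring
  rw [rate, h, Matrix.det_one_add_replicateCol_mul_replicateRow, dotProduct_smul, smul_eq_mul,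
    Complex.add_re, Complex.re_ofReal_mul, Complex.one_re]
  congr 2
  ring

theorem trace_mul_smul_vecMulVec (X : Matrix (Fin M) (Fin M) ℂ) (t : ℝ) (v : Fin M → ℂ) :
    (X * ((t : ℂ) • Matrix.vecMulVec v (star v))).trace.re = t * (star v ⬝ᵥ X *ᵥ v).re := by
  rw [Matrix.mul_smul, Matrix.mul_vecMulVec, Matrix.trace_smul, Matrix.trace_vecMulVec,
    smul_eq_mul, Complex.re_ofReal_mul, dotProduct_comm]

theorem exists_bound_of_dualFunction_lt_top {lam : ℝ} {Z : Matrix (Fin 2) (Fin 2) ℂ}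
    (h : S.dualFunction lam Z < ⊤) :
    ∃ B : ℝ, ∀ Q : Matrix (Fin M) (Fin M) ℂ, Q.PosSemidef →
      S.rate Q - (S.C lam Z * Q).trace.re ≤ B := by
  refine ⟨(S.dualFunction lam Z).toReal - (lam * S.P - (Z 0 0).re / S.Γt), fun Q hQ => ?_⟩
  have h1 := (S.lagrangian_le_dualFunction hQ lam Z).trans (EReal.le_coe_toReal h.ne)
  rw [EReal.coe_le_coe_iff, lagrangian_eq] at h1
  linarith

/-- On the ray t v vᴴ the objective is log₂(1 + tN) - tq, with `N` proportional to ‖H_c v‖² and q =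
vᴴXv. It is unbounded if q < 0, and also if q = 0 < N. -/
theorem nonneg_and_mulVec_eq_zero_of_bound {X : Matrix (Fin M) (Fin M) ℂ} (hσc : 0 < S.σc) {B : ℝ}
    (hB : ∀ Q : Matrix (Fin M) (Fin M) ℂ, Q.PosSemidef → S.rate Q - (X * Q).trace.re ≤ B)
    (v : Fin M → ℂ) :
    0 ≤ (star v ⬝ᵥ X *ᵥ v).re ∧ ((star v ⬝ᵥ X *ᵥ v).re = 0 → S.Hc *ᵥ v = 0) := by
  have hN : 0 ≤ (star (S.Hc *ᵥ v) ⬝ᵥ (S.Hc *ᵥ v)).re :=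
    (Complex.nonneg_iff.1 (dotProduct_star_self_nonneg _)).1
  have hray : ∀ t : ℝ, 0 ≤ t →
      Real.logb 2 (1 + t * ((star (S.Hc *ᵥ v) ⬝ᵥ (S.Hc *ᵥ v)).re / S.σc ^ 2)) -
        t * (star v ⬝ᵥ X *ᵥ v).re ≤ B := by
    intro t ht
    have := hB ((t : ℂ) • Matrix.vecMulVec v (star v))
      ((Matrix.posSemidef_vecMulVec_self_star v).smul (Complex.zero_le_real.2 ht))
    rwa [rate_smul_vecMulVec, trace_mul_smul_vecMulVec] at this
  constructor
  · by_contra! hneg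
    have ht : 0 ≤ (|B| + 1) / (-(star v ⬝ᵥ X *ᵥ v).re) := by
      have := abs_nonneg B
      apply div_nonneg <;> linarith
    have h1 := hray _ ht
    have h2 : 0 ≤ Real.logb 2 (1 + (|B| + 1) / (-(star v ⬝ᵥ X *ᵥ v).re) *
        ((star (S.Hc *ᵥ v) ⬝ᵥ (S.Hc *ᵥ v)).re / S.σc ^ 2)) := by
      refine Real.logb_nonneg one_lt_two ?_
      have := mul_nonneg ht (div_nonneg hN (sq_nonneg S.σc))
      linarith
    have h3 : (|B| + 1) / (-(star v ⬝ᵥ X *ᵥ v).re) * (star v ⬝ᵥ X *ᵥ v).re = -(|B| + 1) := by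
      field_simp [hneg.ne]
    rw [h3] at h1
    linarith [le_abs_self B]
  · intro hq
    by_contra hv
    have hN' : 0 < (star (S.Hc *ᵥ v) ⬝ᵥ (S.Hc *ᵥ v)).re / S.σc ^ 2 :=
      div_pos (Complex.pos_iff.1 (Matrix.dotProduct_star_self_pos_iff.2 hv)).1 (by positivity)
    generalize (star (S.Hc *ᵥ v) ⬝ᵥ (S.Hc *ᵥ v)).re / S.σc ^ 2 = N at *
    -- At this `t` the rate is log₂(1 + 2^(B+1)) > B.
    have h1 := hray ((2 : ℝ) ^ (B + 1) / N) (by positivity)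
    rw [hq, mul_zero, sub_zero, div_mul_cancel₀ _ hN'.ne'] at h1
    have h2 : Real.logb 2 ((2 : ℝ) ^ (B + 1)) ≤ Real.logb 2 (1 + (2 : ℝ) ^ (B + 1)) :=
      Real.logb_le_logb_of_le one_lt_two (by positivity) (by linarith)
    rw [Real.logb_rpow two_pos (by norm_num)] at h2
    linarith

end PointTarget

/-- An eigenvector of `X` for the eigenvalue 0 is killed by `H`, hence orthogonal to each right
singular vector with `ζ k ≠ 0`. Expanding such a singular vector in the columns of `U` therefore
uses active columns only. -/
theorem activeRange_le_of_mulVec_eq_zero {m n : ℕ} {H : Matrix (Fin m) (Fin n) ℂ}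
    {X : Matrix (Fin n) (Fin n) ℂ} (hker : ∀ v, X *ᵥ v = 0 → H *ᵥ v = 0)
    {Uc : Matrix (Fin m) (Fin m) ℂ} {ζ : Fin n → ℝ} {V U : Matrix (Fin n) (Fin n) ℂ}
    {d : Fin n → ℝ} (hH : IsSVD H Uc ζ V) (hX : IsEVD X U d) :
    activeRange V ζ ≤ activeRange U d := by
  have hUU : U * Uᴴ = 1 := Matrix.mem_unitaryGroup_iff.1 hX.unitary
  have hUU' : Uᴴ * U = 1 := Matrix.mem_unitaryGroup_iff'.1 hX.unitary
  have hUc' : Ucᴴ * Uc = 1 := Matrix.mem_unitaryGroup_iff'.1 hH.unitary_left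
  have horth : ∀ j, d j = 0 → ∀ k, ζ k ≠ 0 → (Uᴴ * V) j k = 0 := by
    intro j hj k hk
    have hXU : X * U = U * Matrix.diagonal fun k => (d k : ℂ) := by
      rw [hX.eq, Matrix.mul_assoc, hUU', Matrix.mul_one]
    have h1 : X *ᵥ (fun i => U i j) = 0 := by
      ext i
      have := congrFun (congrFun hXU i) j
      rw [Matrix.mul_diagonal, hj, Complex.ofReal_zero, mul_zero] at this
      exact this
    have h2 : ∀ i, (H * U) i j = 0 := fun i => congrFun (hker _ h1) i
    have hkm : (k : ℕ) < m := by
      by_contra h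
      exact hk (hH.padded k (not_lt.1 h))
    have h3 : (Ucᴴ * (H * U)) ⟨k, hkm⟩ j = 0 := by
      rw [Matrix.mul_apply]
      exact Finset.sum_eq_zero fun i _ => by rw [h2, mul_zero]
    rw [hH.eq, Matrix.mul_assoc, Matrix.mul_assoc Uc, ← Matrix.mul_assoc Ucᴴ, hUc',
      Matrix.one_mul, Matrix.mul_apply, Finset.sum_eq_single k] at h3
    · have h4 : (Vᴴ * U) k j = 0 := by
        simpa [hk] using h3
      have h5 : Uᴴ * V = (Vᴴ * U)ᴴ := by
        rw [Matrix.conjTranspose_mul, Matrix.conjTranspose_conjTranspose]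
      rw [h5, Matrix.conjTranspose_apply, h4, star_zero]
    · intro l _ hl
      have : (k : ℕ) ≠ l := fun h => hl (Fin.ext h.symm)
      simp [this]
    · simp
  refine Submodule.span_le.2 ?_
  rintro _ ⟨k, hk, rfl⟩
  have hV : (fun i => V i k) = ∑ j, (Uᴴ * V) j k • fun i => U i j := by
    ext i
    have : V = U * (Uᴴ * V) := by rw [← Matrix.mul_assoc, hUU, Matrix.one_mul]
    conv_lhs => rw [this, Matrix.mul_apply]
    rw [Finset.sum_apply]
    exact Finset.sum_congr rfl fun j _ => mul_comm _ _
  change (fun i => V i k) ∈ activeRange U d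
  rw [hV]
  refine Submodule.sum_mem _ fun j _ => ?_
  by_cases hj : d j = 0
  · rw [horth j hj k hk, zero_smul]
    exact Submodule.zero_mem _
  · exact Submodule.smul_mem _ _ (Submodule.subset_span ⟨j, hj, rfl⟩)

namespace PointTarget

variable {Nc Ns M : ℕ} (S : PointTarget Nc Ns M)

theorem posSemidef_C_and_mulVec_eq_zero (hσc : 0 < S.σc) {lam : ℝ}
    {Z : Matrix (Fin 2) (Fin 2) ℂ} (hZ : Z.PosSemidef) (h : S.dualFunction lam Z < ⊤) :
    (S.C lam Z).PosSemidef ∧ ∀ v, S.C lam Z *ᵥ v = 0 → S.Hc *ᵥ v = 0 := by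
  obtain ⟨B, hB⟩ := S.exists_bound_of_dualFunction_lt_top h
  have key := S.nonneg_and_mulVec_eq_zero_of_bound hσc hB
  have hC := S.isHermitian_C lam hZ.1
  refine ⟨Matrix.PosSemidef.of_dotProduct_mulVec_nonneg hC fun x => ?_, fun v hv => ?_⟩
  · rw [Complex.nonneg_iff]
    exact ⟨(key x).1, by simpa using (hC.im_star_dotProduct_mulVec_self x).symm⟩
  · exact (key v).2 (by rw [hv, dotProduct_zero, Complex.zero_re])

/-! ### The primal optimum when C is positive definite -/

theorem rate_congruence {B V : Matrix (Fin M) (Fin M) ℂ} {U : Matrix (Fin Nc) (Fin Nc) ℂ}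
    {ζ : Fin M → ℝ} (hB : B.IsHermitian) (hG : IsSVD (S.Hc * B) U ζ V)
    {D : Matrix (Fin M) (Fin M) ℂ} (hD : D = Matrix.diagonal fun k => (ζ k : ℂ))
    (W : Matrix (Fin M) (Fin M) ℂ) :
    S.rate (B * V * W * Vᴴ * B) =
      Real.logb 2 (1 + ((1 / S.σc ^ 2 : ℝ) : ℂ) • (D * W * D)).det.re := by
  obtain ⟨T, hT, hTT⟩ := hG.exists_eq_mul
  rw [← hD] at hTT
  have hVV : Vᴴ * V = 1 := Matrix.mem_unitaryGroup_iff'.1 hG.unitary_right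
  have hUU : Uᴴ * U = 1 := Matrix.mem_unitaryGroup_iff'.1 hG.unitary_left
  have hGV : S.Hc * B * V = U * T := by
    rw [hT, Matrix.mul_assoc, hVV, Matrix.mul_one]
  have hGV' : Vᴴ * B * S.Hcᴴ = Tᴴ * Uᴴ := by
    rw [← Matrix.conjTranspose_mul, ← hGV, Matrix.conjTranspose_mul, Matrix.conjTranspose_mul,
      hB.eq, Matrix.mul_assoc]
  have h1 : S.Hc * (B * V * W * Vᴴ * B) * S.Hcᴴ = U * (T * W * Tᴴ * Uᴴ) := by
    calc S.Hc * (B * V * W * Vᴴ * B) * S.Hcᴴ = (S.Hc * B * V) * W * (Vᴴ * B * S.Hcᴴ) := by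
          simp only [Matrix.mul_assoc]
      _ = _ := by
          rw [hGV, hGV']
          simp only [Matrix.mul_assoc]
  rw [rate, h1]
  generalize ((1 / S.σc ^ 2 : ℝ) : ℂ) = c
  congr 2
  -- Three uses of det(1 + XY) = det(1 + YX): cancel `U`, form `Tᴴ * T = D * D`, then move one `D`
  -- to the other side.
  rw [← Matrix.mul_smul, Matrix.det_one_add_mul_comm, Matrix.smul_mul, Matrix.mul_assoc, hUU,
    Matrix.mul_one, ← Matrix.smul_mul, Matrix.det_one_add_mul_comm, Matrix.mul_smul,
    ← Matrix.mul_assoc, hTT, Matrix.mul_assoc, ← Matrix.mul_smul, Matrix.det_one_add_mul_comm,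
    Matrix.smul_mul]

theorem eq_waterFilling_of_lagrangian_max (hσc : 0 < S.σc) {lam : ℝ} {Z : Matrix (Fin 2) (Fin 2) ℂ}
    (hC : (S.C lam Z).PosDef) {UG : Matrix (Fin Nc) (Fin Nc) ℂ} {ζ : Fin M → ℝ}
    {VG : Matrix (Fin M) (Fin M) ℂ} (hG : IsSVD (S.Hc * invSqrt (S.C lam Z)) UG ζ VG)
    {Q : Matrix (Fin M) (Fin M) ℂ} (hQ : Q.PosSemidef)
    (hmax : ∀ Q' : Matrix (Fin M) (Fin M) ℂ, Q'.PosSemidef →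
      S.lagrangian Q' lam Z ≤ S.lagrangian Q lam Z) :
    Q = invSqrt (S.C lam Z) * VG *
      Matrix.diagonal (fun k => (waterFilling S.σc (ζ k) : ℂ)) * VGᴴ * invSqrt (S.C lam Z) := by
  have hBh := invSqrt_isHermitian (S.C lam Z)
  have hBBC := invSqrt_mul_self hC
  have hrate := S.rate_congruence hBh hG rfl
  have hL := fun Q => S.lagrangian_eq Q lam Z
  generalize invSqrt (S.C lam Z) = B at *
  generalize S.C lam Z = X at *
  set P := Matrix.diagonal (fun k => (waterFilling S.σc (ζ k) : ℂ)) with hP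
  have hVV : VGᴴ * VG = 1 := Matrix.mem_unitaryGroup_iff'.1 hG.unitary_right
  have hVV' : VG * VGᴴ = 1 := Matrix.mem_unitaryGroup_iff.1 hG.unitary_right
  have hBXB : B * X * B = 1 := mul_eq_one_comm.1 (by rw [← Matrix.mul_assoc]; exact hBBC)
  have hXB : X * B * B = 1 := by
    rw [Matrix.mul_assoc]
    exact mul_eq_one_comm.1 hBBC
  have htr : ∀ W, (X * (B * VG * W * VGᴴ * B)).trace = W.trace := by
    intro W
    calc (X * (B * VG * W * VGᴴ * B)).trace = (X * B * VG * W * VGᴴ * B).trace := by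
          simp only [Matrix.mul_assoc]
      _ = ((B * X * B) * VG * W * VGᴴ).trace := by
          rw [Matrix.trace_mul_comm]
          simp only [Matrix.mul_assoc]
      _ = ((VGᴴ * VG) * W).trace := by
          rw [hBXB, Matrix.one_mul, Matrix.trace_mul_comm, Matrix.mul_assoc]
      _ = W.trace := by rw [hVV, Matrix.one_mul]
  -- Since `B * X * B = 1`, both `B * X` and `X * B` invert `B`; this `W` solves `Q = B * VG * W *
  -- VGᴴ * B`.
  set W := VGᴴ * (B * X) * Q * (X * B) * VG with hWdef
  have hQW : Q = B * VG * W * VGᴴ * B := by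
    symm
    calc B * VG * W * VGᴴ * B
        = B * (VG * VGᴴ) * (B * X) * Q * (X * B) * (VG * VGᴴ) * B := by
          simp only [hWdef, Matrix.mul_assoc]
      _ = (B * B * X) * Q * (X * B * B) := by
          rw [hVV', Matrix.mul_one, Matrix.mul_one]
          simp only [Matrix.mul_assoc]
      _ = Q := by rw [hBBC, hXB, Matrix.one_mul, Matrix.mul_one]
  have hW : W.PosSemidef := by
    have := hQ.mul_mul_conjTranspose_same (VGᴴ * (B * X))
    rw [Matrix.conjTranspose_mul, Matrix.conjTranspose_mul, Matrix.conjTranspose_conjTranspose,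
      hBh.eq, hC.1.eq] at this
    rw [hWdef]
    simpa only [Matrix.mul_assoc] using this
  have hPpos : P.PosSemidef := by
    rw [hP]
    refine Matrix.PosSemidef.diagonal fun k => ?_
    exact Complex.zero_le_real.2 (waterFilling_spec hσc (ζ k)).1
  have hQ₀ : (B * VG * P * VGᴴ * B).PosSemidef := by
    have := hPpos.mul_mul_conjTranspose_same (B * VG)
    rw [Matrix.conjTranspose_mul, hBh.eq] at this
    simpa only [Matrix.mul_assoc] using this
  have h1 := hmax _ hQ₀
  rw [hL, hL, hrate, htr, hQW, hrate, htr] at h1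
  have h2 := (waterFilling_optimal hσc ζ hW rfl hP).2 (by linarith)
  rw [hQW, h2]

end PointTarget

end ISAC

theorem mainTheorem4 {Nc Ns M : ℕ} (S : ISAC.PointTarget Nc Ns M)
    (hα : S.α ≠ 0) (hL : 0 < S.L) (hσs : 0 < S.σs) (hσc : 0 < S.σc) (hP : 0 < S.P) (hΓ : 0 < S.Γ)
    -- the CRB threshold exceeds the smallest CRB that the power budget permits
    (hCRB : ∃ Q : Matrix (Fin M) (Fin M) ℂ, Q.PosSemidef ∧ Q.trace.re ≤ S.P ∧
      0 < S.angleInfo Q ∧ S.CRB Q < S.Γ) :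
    -- the matrix inequality expresses the CRB constraint
    (∀ Q : Matrix (Fin M) (Fin M) ℂ, Q.PosSemidef → 0 < (S.Aᴴ * S.A * Q).trace.re →
      ((S.crbMatrix Q).PosSemidef ↔ 0 < S.angleInfo Q ∧ S.CRB Q ≤ S.Γ)) ∧
    -- the problem is convex
    ConcaveOn ℝ {Q : Matrix (Fin M) (Fin M) ℂ | Q.PosSemidef} S.rate ∧
    Convex ℝ {Q : Matrix (Fin M) (Fin M) ℂ | (S.crbMatrix Q).PosSemidef} ∧
    Convex ℝ {Q : Matrix (Fin M) (Fin M) ℂ | Q.trace.re ≤ S.P} ∧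
    Convex ℝ S.feasibleSet ∧
    -- strong duality, with both optima attained
    (∃ (Q : Matrix (Fin M) (Fin M) ℂ) (lam : ℝ) (Z : Matrix (Fin 2) (Fin 2) ℂ),
      S.IsPrimalOptimal Q ∧ S.IsDualOptimal lam Z ∧ S.dualFunction lam Z = (S.rate Q : EReal)) ∧
    -- necessary conditions for a finite value of the dual function
    (∀ (lam : ℝ) (Z : Matrix (Fin 2) (Fin 2) ℂ), 0 ≤ lam → Z.PosSemidef →
      S.dualFunction lam Z < ⊤ →
      (S.C lam Z).PosSemidef ∧
      ∀ (Uc : Matrix (Fin Nc) (Fin Nc) ℂ) (ζc : Fin M → ℝ) (Vc : Matrix (Fin M) (Fin M) ℂ)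
        (U : Matrix (Fin M) (Fin M) ℂ) (d : Fin M → ℝ),
        ISAC.IsSVD S.Hc Uc ζc Vc → ISAC.IsEVD (S.C lam Z) U d →
        ISAC.activeRange Vc ζc ≤ ISAC.activeRange U d) ∧
    -- the optimal covariance if `C` is positive definite at a dual optimum
    (∀ (lam : ℝ) (Z : Matrix (Fin 2) (Fin 2) ℂ), S.IsDualOptimal lam Z → (S.C lam Z).PosDef →
      ∀ (UG : Matrix (Fin Nc) (Fin Nc) ℂ) (ζ : Fin M → ℝ) (VG : Matrix (Fin M) (Fin M) ℂ),
        ISAC.IsSVD (S.Hc * ISAC.invSqrt (S.C lam Z)) UG ζ VG →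
        ∀ Q : Matrix (Fin M) (Fin M) ℂ, S.IsPrimalOptimal Q ↔
          Q = ISAC.invSqrt (S.C lam Z) * VG *
            Matrix.diagonal (fun k => (ISAC.waterFilling S.σc (ζ k) : ℂ)) * VGᴴ *
            ISAC.invSqrt (S.C lam Z)) := by
  have hΓt := S.Γt_pos hα hL hσs hΓ
  obtain ⟨Q, lam, Z, hQ, hlam, hZ, hle⟩ := S.exists_isPrimalOptimal_and_multipliers
    (S.exists_strictly_feasible hσs hP hΓ hΓt hCRB)
  have hdual := S.isDualOptimal_of_lagrangian_le hQ.1 hlam hZ hle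
  refine ⟨fun Q hQ ht => S.posSemidef_crbMatrix_iff_CRB_le hΓt hσs hΓ hQ ht, S.concaveOn_rate,
    S.convex_crb_constraint, S.convex_power_constraint, S.convex_feasibleSet,
    ⟨Q, lam, Z, hQ, hdual.1, hdual.2⟩, fun lam' Z' _ hZ' hlt => ?_,
    fun lam' Z' hopt hC UG ζ VG hG => ?_⟩
  · have h := S.posSemidef_C_and_mulVec_eq_zero hσc hZ' hlt
    exact ⟨h.1, fun Uc ζc Vc U d hH hE => ISAC.activeRange_le_of_mulVec_eq_zero h.2 hH hE⟩
  · have huniq : ∀ Q' : Matrix (Fin M) (Fin M) ℂ, S.IsPrimalOptimal Q' →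
        Q' = ISAC.invSqrt (S.C lam' Z') * VG *
          Matrix.diagonal (fun k => (ISAC.waterFilling S.σc (ζ k) : ℂ)) * VGᴴ *
          ISAC.invSqrt (S.C lam' Z') := by
      intro Q' hQ'
      refine S.eq_waterFilling_of_lagrangian_max hσc hC hG hQ'.1.1 fun Q'' hQ'' => ?_
      -- `Q'` maximizes the Lagrangian at any dual optimum: L(Q'') ≤ g(λ', Z') ≤ g(λ, Z) = R(Q) ≤
      -- R(Q') ≤ L(Q').
      have h1 := S.rate_le_lagrangian hQ'.1 hopt.1 hopt.2.1
      have h2 : S.lagrangian Q'' lam' Z' ≤ S.rate Q := by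
        rw [← EReal.coe_le_coe_iff, ← hdual.2]
        exact (S.lagrangian_le_dualFunction hQ'' lam' Z').trans (hopt.2.2 lam Z hlam hZ)
      exact h2.trans ((hQ'.2 Q hQ.1).trans h1)
    -- Feasibility of the closed form is never checked directly: an optimum `Q` exists, and it must
    -- equal that form.
    refine fun Q' => ⟨huniq Q', fun h => ?_⟩
    rw [h, ← huniq Q hQ]
    exact hQ
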